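/- Let \(K\) be an algebraically closed field of arbitrary characteristic and let \(n\ge 1\). For \(f\in K[[\boldsymbol x]]=K[[x_1,\dots,x_n]]\) let \(\mathrm{j}(f)=\langle f_{x_1},\dots,f_{x_n}\rangle\) and \(\mathrm{tj}(f)=\langle f,f_{x_1},\dots,f_{x_n}\rangle\), and let \[ \mu(f)=\dim_K K[[\boldsymbol x]]/\mathrm{j}(f),\qquad \tau(f)=\dim_K K[[\boldsymbol x]]/\mathrm{tj}(f) \] be the Milnor and Tjurina numbers, with values in \(\mathbb N\cup\{\infty\}\). For a weight vector \(w\in\mathbb Z_{>0}^n\) and \(f=\sum_\alpha a_\alpha \boldsymbol x^\alpha\), let \(\mathrm{In}_w(f)\) be the sum of those terms \(a_\alpha\boldsymbol x^\alpha\) of \(f\) for which the weighted degree \(w\cdot\alpha=\sum_i w_i\alpha_i\) is minimal among the terms of \(f\) with \(a_\alpha\neq 0\) (and \(\mathrm{In}_w(0)=0\)); if \(f\neq 0\), let \(\deg_w(\mathrm{In}_w(f))\) be this minimal weighted degree. We call \(f\) *right* (resp. *contact*) *semi-quasihomogeneous* with respect to \(w\) if \(\mu(\mathrm{In}_w(f))<\infty\)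 (resp. \(\tau(\mathrm{In}_w(f))<\infty\)). Power series \(f,g\) are *right equivalent* if \(g=\varphi(f)\), and *contact equivalent* if \(g=u\cdot\varphi(f)\), for some \(K\)-algebra automorphism \(\varphi\) of \(K[[\boldsymbol x]]\) and (in the second case) some unit \(u\in K[[\boldsymbol x]]\). **Proposition.** Let \(f\in K[[\boldsymbol x]]\) and \(w\in\mathbb Z_{>0}^n\). (a) If \(\mu(\mathrm{In}_w(f))<\infty\) and \(d=\deg_w(\mathrm{In}_w(f))\), then \[ \mu(f)=\mu(\mathrm{In}_w(f))=\left(\frac{d}{w_1}-1\right)\cdots\left(\frac{d}{w_n}-1\right)<\infty . \] (b) In any case, \(\tau(f)\le\tau(\mathrm{In}_w(f))\). In particular, if \(f\) is right semi-quasihomogeneous with respect to \(w\), then \(\mu(f)<\infty\), and \(\mu(g)<\infty\) for every \(g\) right equivalent to \(f\); if \(f\) is contact semi-quasihomogeneous with respect to \(w\), then \(\tau(f)<\infty\), and \(\tau(g)<\infty\) for every \(g\) contact equivalent to \(f\). That is, semi-quasihomogeneous singularities are isolated in any characteristic. -/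

import Mathlib

noncomputable section

namespace PowerSeriesSingularity

open MvPowerSeries

variable {K : Type*} [Field K] {n : ℕ}

/-- The Jacobian ideal `j(f) = ⟨f_{x_1}, …, f_{x_n}⟩` of `K[[x_1, …, x_n]]`. -/
def jacobianIdeal (f : MvPowerSeries (Fin n) K) : Ideal (MvPowerSeries (Fin n) K) :=
  Ideal.span (Set.range fun i : Fin n => MvPowerSeries.pderiv K i f)

/-- The Tjurina ideal `tj(f) = ⟨f⟩ + j(f)`. -/
def tjurinaIdeal (f : MvPowerSeries (Fin n) K) : Ideal (MvPowerSeries (Fin n) K) :=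
  Ideal.span {f} ⊔ jacobianIdeal f

/-- The Milnor number `μ(f) = dim_K K[[x]] / j(f)`, with value `⊤` if the dimension is infinite. -/
def milnorNumber (f : MvPowerSeries (Fin n) K) : ℕ∞ :=
  Cardinal.toENat (Module.rank K (MvPowerSeries (Fin n) K ⧸ jacobianIdeal f))

/-- The Tjurina number `τ(f) = dim_K K[[x]] / tj(f)`, with value `⊤` if the dimension is
infinite. -/
def tjurinaNumber (f : MvPowerSeries (Fin n) K) : ℕ∞ :=
  Cardinal.toENat (Module.rank K (MvPowerSeries (Fin n) K ⧸ tjurinaIdeal f))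

/-- `f` is an isolated singularity: `μ(f) < ∞`. -/
def IsIsolatedSingularity (f : MvPowerSeries (Fin n) K) : Prop :=
  milnorNumber f < ⊤

/-- `R_f = K[[x]] / ⟨f⟩` is an isolated hypersurface singularity: `τ(f) < ∞`. -/
def IsIsolatedHypersurfaceSingularity (f : MvPowerSeries (Fin n) K) : Prop :=
  tjurinaNumber f < ⊤

/-- The initial form (principal part) `In_w(f)`: the sum of the terms `a_α x^α` of `f` whose
weighted degree `w · α` is minimal among the terms of `f`. -/
def initialForm (w : Fin n → ℕ) (f : MvPowerSeries (Fin n) K) : MvPowerSeries (Fin n) K :=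
  weightedHomogeneousComponent w (f.weightedOrder w).toNat f

open scoped Classical in
/-- The coefficients of the initial form. -/
theorem coeff_initialForm (w : Fin n → ℕ) (f : MvPowerSeries (Fin n) K) (α : Fin n →₀ ℕ) :
    coeff α (initialForm w f) =
      if ∀ β : Fin n →₀ ℕ, coeff β f ≠ 0 → Finsupp.weight w α ≤ Finsupp.weight w β
      then coeff α f else 0 := by
  rw [initialForm, coeff_weightedHomogeneousComponent]
  by_cases h0 : coeff α f = 0
  · simp [h0]
  have hf : f ≠ 0 := by
    rintro rfl
    exact h0 (by simp)
  have hfin := (ne_zero_iff_weightedOrder_finite w).1 hf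
  congr 1
  apply propext
  constructor
  · intro h β hβ
    have := weightedOrder_le w hβ
    rw [h]
    rw [← hfin] at this
    exact_mod_cast this
  · intro h
    obtain ⟨β, hβ, hw⟩ := exists_coeff_ne_zero_and_weightedOrder w hfin
    have h1 := weightedOrder_le w h0
    rw [← hfin] at h1 hw
    have h1' : (f.weightedOrder w).toNat ≤ Finsupp.weight w α := by exact_mod_cast h1
    have hw' : (f.weightedOrder w).toNat = Finsupp.weight w β := by exact_mod_cast hw.symm
    have := h β hβ
    omega

/-- `f` is right semi-quasihomogeneous (rSQH) with respect to `w`. -/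
def IsRightSemiQuasihomogeneous (w : Fin n → ℕ) (f : MvPowerSeries (Fin n) K) : Prop :=
  milnorNumber (initialForm w f) < ⊤

/-- `f` is contact semi-quasihomogeneous (cSQH) with respect to `w`. -/
def IsContactSemiQuasihomogeneous (w : Fin n → ℕ) (f : MvPowerSeries (Fin n) K) : Prop :=
  tjurinaNumber (initialForm w f) < ⊤

/-- Right equivalence: `f = φ(g)` for an automorphism `φ` of the `K`-algebra `K[[x]]`. -/
def RightEquivalent (f g : MvPowerSeries (Fin n) K) : Prop :=
  ∃ φ : MvPowerSeries (Fin n) K ≃ₐ[K] MvPowerSeries (Fin n) K, f = φ g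

/-- Contact equivalence: `f = u · φ(g)` for a unit `u` and an automorphism `φ` of the
`K`-algebra `K[[x]]`. -/
def ContactEquivalent (f g : MvPowerSeries (Fin n) K) : Prop :=
  ∃ (φ : MvPowerSeries (Fin n) K ≃ₐ[K] MvPowerSeries (Fin n) K)
    (u : (MvPowerSeries (Fin n) K)ˣ), f = u * φ g

end PowerSeriesSingularity

end

open PowerSeriesSingularity

/-! Write `F` for the initial form, of weighted degree `d`. Differentiation lowers weighted degree
in every characteristic: a nonzero `∂ᵢF` is homogeneous of degree `d - wᵢ`, and `∂ᵢf - ∂ᵢF` has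
larger order. No Euler relation is needed, so the question is how an ideal `⟨gᵢ⟩` compares with the
ideal `⟨Gᵢ⟩` of homogeneous leading parts.

If `⟨Gᵢ⟩` has finite colength, cancelling one degree at a time shows that monomials spanning the
quotient by `⟨Gᵢ⟩` also span the quotient by `⟨gᵢ⟩` (`exists_span_sub_mem_of_initialForms`). Applied
to `F` and its partials, this is (b).

For (a), if some `∂ᵢF` is a unit, then `d = wᵢ` and everything is zero. Otherwise the `∂ᵢF` are `n`
elements of the maximal ideal of finite colength, hence a regular sequence
(`isRegularFamily_of_finite`): their ideal contains the regular sequence `xᵢ ^ N`, and an exchange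
argument carries regularity over to the generators. Regularity lifts syzygies of the `Gᵢ` to the
`gᵢ`, so no new leading forms appear and a monomial basis modulo `j(F)` stays independent modulo
`j(f)` (`IsRegularFamily.linearIndependent`). Its cardinality is the value at `t = 1` of the Hilbert
polynomial `∏ (1 - t ^ (d - wᵢ)) / (1 - t ^ wᵢ)`.

Finiteness is invariant under both equivalences by a chain rule for derivations. -/

namespace RegularSequenceExchange

/-! ### Exchange of regular sequences in a Noetherian local ring. -/

open RingTheory.Sequence IsLocalRing Pointwise

universe u v

variable {R : Type u} [CommRing R] [IsNoetherianRing R]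

/-- An ideal consisting of zero divisors on a finite module kills a nonzero element. -/
theorem exists_ne_zero_forall_smul_eq_zero {N : Type v} [AddCommGroup N] [Module R N]
    [Module.Finite R N] (I : Ideal R) (h : ∀ r ∈ I, ¬ IsSMulRegular N r) :
    ∃ c : N, c ≠ 0 ∧ ∀ r ∈ I, r • c = 0 := by
  have hsub : (I : Set R) ⊆ ⋃ p ∈ associatedPrimes R N, (p : Set R) := by
    rw [biUnion_associatedPrimes_eq_compl_regular]
    exact fun r hr => h r hr
  have hfin := associatedPrimes.finite R N
  obtain ⟨p, hp, hIp⟩ := (Ideal.subset_union_prime_finite hfin (f := fun p => p) ⊥ ⊥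
    (fun p hp _ _ => hp.isPrime)).1 hsub
  obtain ⟨hprime, c, hc⟩ := Submodule.isAssociatedPrime_iff.1 (AssociatedPrimes.mem_iff.1 hp)
  refine ⟨c, ?_, fun r hr => ?_⟩
  · rintro rfl
    apply hprime.ne_top
    rw [hc]
    ext; simp [Submodule.mem_colon_singleton]
  · have : r ∈ p := hIp hr
    rw [hc] at this
    simpa [Submodule.mem_colon_singleton] using this

/-- Prime avoidance on the product `N₁ × N₂`: if no element of `I` were regular on both, some
nonzero pair would be killed by `I`, and so would its nonzero component. -/
theorem exists_isSMulRegular_pair {N₁ N₂ : Type v} [AddCommGroup N₁] [Module R N₁]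
    [Module.Finite R N₁] [AddCommGroup N₂] [Module R N₂] [Module.Finite R N₂] (I : Ideal R)
    (h₁ : ∀ c : N₁, (∀ r ∈ I, r • c = 0) → c = 0)
    (h₂ : ∀ c : N₂, (∀ r ∈ I, r • c = 0) → c = 0) :
    ∃ y ∈ I, IsSMulRegular N₁ y ∧ IsSMulRegular N₂ y := by
  by_contra! hcon
  obtain ⟨c, hc, h⟩ := exists_ne_zero_forall_smul_eq_zero (N := N₁ × N₂) I (fun r hr hreg => by
    refine hcon r hr ?_ ?_
    · intro a b hab
      have := @hreg (a, 0) (b, 0) (by simpa using hab)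
      simpa using this
    · intro a b hab
      have := @hreg (0, a) (0, b) (by simpa using hab)
      simpa using this)
  apply hc
  ext
  · exact h₁ _ fun r hr => congrArg Prod.fst (h r hr)
  · exact h₂ _ fun r hr => congrArg Prod.snd (h r hr)

-- Rephrases a depth condition on `M / xM` by elements of `M`, so that it can be compared for two
-- different choices of `x`.
omit [IsNoetherianRing R] in
theorem quotSMulTop_forall {M : Type v} [AddCommGroup M] [Module R M] (x : R) (I : Ideal R) :
    (∀ c : QuotSMulTop x M, (∀ r ∈ I, r • c = 0) → c = 0) ↔
      ∀ c : M, (∀ r ∈ I, ∃ e : M, r • c = x • e) → ∃ e : M, c = x • e := by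
  have key : ∀ c : M, (Submodule.Quotient.mk c : QuotSMulTop x M) = 0 ↔ ∃ e : M, c = x • e := by
    intro c
    rw [Submodule.Quotient.mk_eq_zero, Submodule.mem_smul_pointwise_iff_exists]
    simp [eq_comm]
  constructor
  · intro h c hc
    rw [← key]
    refine h _ fun r hr => ?_
    rw [← Submodule.Quotient.mk_smul, key]
    exact hc r hr
  · intro h c hc
    obtain ⟨c, rfl⟩ := Submodule.Quotient.mk_surjective _ c
    rw [key]
    refine h c fun r hr => ?_
    rw [← key, Submodule.Quotient.mk_smul]
    exact hc r hr

variable [IsLocalRing R]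

theorem isWeaklyRegular_swap {M : Type v} [AddCommGroup M] [Module R M] [Module.Finite R M]
    {x y : R} {rs : List R} (hx : x ∈ maximalIdeal R) (hy : y ∈ maximalIdeal R)
    (hrs : ∀ r ∈ rs, r ∈ maximalIdeal R) (h : IsWeaklyRegular M (x :: y :: rs)) :
    IsWeaklyRegular M (y :: x :: rs) := by
  refine IsLocalRing.isWeaklyRegular_of_perm_of_subset_maximalIdeal h (List.Perm.swap _ _ _) ?_
  exact List.forall_mem_cons.2 ⟨hx, List.forall_mem_cons.2 ⟨hy, hrs⟩⟩

/-- If an ideal contains a regular sequence of length `n + 1`, then any regular element of the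
ideal extends to such a sequence. -/
theorem exists_isWeaklyRegular_cons (I : Ideal R) (hI : I ≤ maximalIdeal R) (n : ℕ) :
    ∀ (M : Type v) [AddCommGroup M] [Module R M] [Module.Finite R M] (rs : List R),
      rs.length = n + 1 → (∀ r ∈ rs, r ∈ I) → IsWeaklyRegular M rs →
      ∀ b ∈ I, IsSMulRegular M b →
      ∃ rs' : List R, rs'.length = n ∧ (∀ r ∈ rs', r ∈ I) ∧ IsWeaklyRegular M (b :: rs') := by
  induction n with
  | zero =>
    intro M _ _ _ rs _ _ _ b _ hb
    exact ⟨[], rfl, by simp, IsWeaklyRegular.cons hb (IsWeaklyRegular.nil R _)⟩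
  | succ n ih =>
    intro M _ _ _ rs hlen hrs hreg b hbI hb
    obtain ⟨x, rs, rfl⟩ := List.exists_cons_of_length_eq_add_one hlen
    obtain ⟨y, zs, rfl⟩ := List.exists_cons_of_length_eq_add_one
      (show rs.length = n + 1 by simpa using hlen)
    have hxI : x ∈ I := hrs x (by simp)
    have hyI : y ∈ I := hrs y (by simp)
    rw [isWeaklyRegular_cons_iff] at hreg
    obtain ⟨hx, hreg'⟩ := hreg
    have hyx := ((isWeaklyRegular_cons_iff _ _ _).1 hreg').1
    have h₁ : ∀ c : QuotSMulTop x M, (∀ r ∈ I, r • c = 0) → c = 0 := fun c hc =>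
      hyx.right_eq_zero_of_smul (hc y hyI)
    -- Positive depth passes from `M / xM` to `M / bM`. If `I c ⊆ bM`, write `x c = b d`; cancelling
    -- `b` gives `I d ⊆ xM`, so `d = x d'`, and cancelling `x` gives `c = b d'`.
    have h₂ : ∀ c : QuotSMulTop b M, (∀ r ∈ I, r • c = 0) → c = 0 := by
      rw [quotSMulTop_forall] at h₁ ⊢
      intro c hc
      obtain ⟨d, hd⟩ := hc x hxI
      obtain ⟨d', rfl⟩ := h₁ d fun i hi => by
        obtain ⟨e, he⟩ := hc i hi
        refine ⟨e, hb ?_⟩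
        simp only
        rw [smul_comm b i d, ← hd, smul_comm i x c, he, smul_comm x b e]
      refine ⟨d', hx ?_⟩
      simp only
      rw [hd, smul_comm]
    -- The element `z` links `x` to `b`: extend `x, z` to a sequence, swap to `z, x, …`, replace `x`
    -- by `b` on `M / zM`, and swap back to `b, z, …`.
    obtain ⟨z, hzI, hzx, hzb⟩ := exists_isSMulRegular_pair I h₁ h₂
    have hlen' : (y :: zs).length = n + 1 := by simpa using hlen
    obtain ⟨us, hul, huI, hu⟩ := ih (QuotSMulTop x M) (y :: zs) hlen'
      (fun r hr => hrs r (List.mem_cons_of_mem _ hr)) hreg' z hzI hzx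
    have hxz : IsWeaklyRegular M (z :: x :: us) :=
      isWeaklyRegular_swap (hI hxI) (hI hzI) (fun r hr => hI (huI r hr)) (hu.cons hx)
    have hbz : IsWeaklyRegular M [z, b] :=
      isWeaklyRegular_swap (hI hbI) (hI hzI) (by simp)
        (IsWeaklyRegular.cons hb (IsWeaklyRegular.cons hzb (IsWeaklyRegular.nil R _)))
    rw [isWeaklyRegular_cons_iff] at hxz hbz
    obtain ⟨vs, hvl, hvI, hv⟩ := ih (QuotSMulTop z M) (x :: us) (by simp [hul])
      (by simpa [hxI] using huI) hxz.2 b hbI ((isWeaklyRegular_singleton_iff _ _).1 hbz.2)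
    exact ⟨z :: vs, by simp [hvl], by simpa [hzI] using hvI,
      isWeaklyRegular_swap (hI hzI) (hI hbI) (fun r hr => hI (hvI r hr)) (hv.cons hxz.1)⟩

omit [IsNoetherianRing R] [IsLocalRing R] in
theorem isWeaklyRegular_of_smul_eq {M : Type v} [AddCommGroup M] [Module R M] {as bs : List R}
    (h : List.Forall₂ (fun r s : R => ∀ x : M, r • x = s • x) as bs) :
    IsWeaklyRegular M as ↔ IsWeaklyRegular M bs :=
  (AddEquiv.refl M).isWeaklyRegular_congr h

theorem isWeaklyRegular_snoc {M : Type v} [AddCommGroup M] [Module R M] [Module.Finite R M]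
    {a : R} {rs : List R} (ha : a ∈ maximalIdeal R) (hrs : ∀ r ∈ rs, r ∈ maximalIdeal R) :
    IsWeaklyRegular M (a :: rs) ↔ IsWeaklyRegular M rs ∧
      IsSMulRegular (M ⧸ (Ideal.ofList rs • ⊤ : Submodule R M)) a := by
  have hperm : (a :: rs).Perm (rs ++ [a]) := by
    simpa using (List.perm_append_comm (l₁ := [a]) (l₂ := rs))
  rw [← isWeaklyRegular_singleton_iff, ← isWeaklyRegular_append_iff]
  constructor
  · intro h
    exact IsLocalRing.isWeaklyRegular_of_perm_of_subset_maximalIdeal h hperm 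
      (List.forall_mem_cons.2 ⟨ha, hrs⟩)
  · intro h
    refine IsLocalRing.isWeaklyRegular_of_perm_of_subset_maximalIdeal h hperm.symm ?_
    intro r hr
    rw [← hperm.mem_iff] at hr
    rcases List.mem_cons.1 hr with rfl | hr
    exacts [ha, hrs r hr]

omit [IsLocalRing R] in
/-- Prime avoidance in a coset, over an infinite field. -/
theorem exists_isSMulRegular_add (K : Type*) [Field K] [Infinite K] [Algebra K R]
    {M : Type v} [AddCommGroup M] [Module R M] [Module.Finite R M] (a : R) (J : Ideal R) (x : R)
    (hx : IsSMulRegular M x) (hxI : x ∈ Ideal.span {a} ⊔ J) :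
    ∃ s ∈ J, IsSMulRegular M (a + s) := by
  have hfin := associatedPrimes.finite R M
  -- Avoidance becomes linear algebra on pairs `(c, s) ↦ c a + s`. The preimage of each associated
  -- prime is a proper subspace because `x` lies in `⟨a⟩ + J` and in no such prime; adding the
  -- subspace `c = 0` allows a final division by `c`.
  let φ : K × J →ₗ[K] R :=
    ((LinearMap.toSpanSingleton K R a).coprod (J.subtype.restrictScalars K))
  have hφ : ∀ p, φ p = p.1 • a + p.2 := fun p => rfl
  let V : Ideal R → Submodule K (K × J) := fun p => (p.restrictScalars K).comap φ
  let S : Set (Submodule K (K × J)) :=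
    insert (LinearMap.ker (LinearMap.fst K K J)) (V '' associatedPrimes R M)
  have hS : S.Finite := (hfin.image V).insert _
  have htop : ⊤ ∉ S := by
    rintro (h | ⟨p, hp, h⟩)
    · have : ((1 : K), (0 : J)) ∈ LinearMap.ker (LinearMap.fst K K J) := h ▸ trivial
      simp at this
    · have h' : ∀ c, φ c ∈ p := fun c => by
        have : c ∈ V p := h ▸ trivial
        exact this
      have ha : a ∈ p := by simpa [hφ] using h' (1, 0)
      have hJ : J ≤ p := fun s hs => by simpa [hφ] using h' (0, ⟨s, hs⟩)
      have hxp : x ∈ p := (sup_le ((Ideal.span_singleton_le_iff_mem _).2 ha) hJ) hxI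
      have : x ∈ ⋃ p ∈ associatedPrimes R M, (p : Set R) := Set.mem_biUnion hp hxp
      rw [biUnion_associatedPrimes_eq_compl_regular] at this
      exact this hx
  have := Subspace.biUnion_ne_univ_of_top_notMem (s := hS.toFinset)
    (by rwa [Set.Finite.mem_toFinset])
  obtain ⟨⟨c, s⟩, hcs⟩ := (Set.ne_univ_iff_exists_notMem _).1 this
  simp only [Set.Finite.mem_toFinset, Set.mem_iUnion, not_exists, SetLike.mem_coe] at hcs
  have hc : c ≠ 0 := by
    have := hcs _ (Set.mem_insert _ _)
    simpa using this
  refine ⟨c⁻¹ • (s : R), (J.restrictScalars K).smul_mem _ s.2, ?_⟩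
  by_contra hnot
  have : a + c⁻¹ • (s : R) ∈ ⋃ p ∈ associatedPrimes R M, (p : Set R) := by
    rw [biUnion_associatedPrimes_eq_compl_regular]
    exact hnot
  obtain ⟨p, hp, hmem⟩ := Set.mem_iUnion₂.1 this
  refine hcs (V p) (Set.mem_insert_of_mem _ ⟨p, hp, rfl⟩) ?_
  change φ (c, s) ∈ p
  have h2 := (p.restrictScalars K).smul_mem c hmem
  rw [smul_add, smul_inv_smul₀ hc] at h2
  exact h2

/-- If the ideal generated by `n` elements contains a regular sequence of length `n`, then the
generators form a regular sequence. -/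
theorem isWeaklyRegular_of_ofList (K : Type*) [Field K] [Infinite K] [Algebra K R] (n : ℕ) :
    ∀ (M : Type v) [AddCommGroup M] [Module R M] [Module.Finite R M] (as rs : List R),
      as.length = n → rs.length = n → (∀ a ∈ as, a ∈ maximalIdeal R) →
      (∀ r ∈ rs, r ∈ Ideal.ofList as) → IsWeaklyRegular M rs → IsWeaklyRegular M as := by
  induction n with
  | zero =>
    intro M _ _ _ as rs has _ _ _ _
    rw [List.length_eq_zero_iff.1 has]
    exact IsWeaklyRegular.nil R M
  | succ n ih =>
    intro M _ _ _ as rs has hrs hm hrI hreg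
    obtain ⟨a, as, rfl⟩ := List.exists_cons_of_length_eq_add_one has
    have hlen : as.length = n := by simpa using has
    have hm' : ∀ r ∈ as, r ∈ maximalIdeal R := fun r hr => hm r (List.mem_cons_of_mem _ hr)
    have ham : a ∈ maximalIdeal R := hm a (by simp)
    have hle : Ideal.ofList as ≤ maximalIdeal R := Ideal.span_le.2 hm'
    obtain ⟨x, rs₀, rfl⟩ := List.exists_cons_of_length_eq_add_one hrs
    rw [Ideal.ofList_cons] at hrI
    -- The generator `a` may itself be a zero divisor; changing it by an element of the ideal of the
    -- other generators makes it regular.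
    obtain ⟨s, hs, hb⟩ := exists_isSMulRegular_add K a (Ideal.ofList as) x
      ((isWeaklyRegular_cons_iff _ _ _).1 hreg).1 (hrI x (by simp))
    have hbm : a + s ∈ maximalIdeal R := add_mem ham (hle hs)
    have hI : Ideal.span {a} ⊔ Ideal.ofList as ≤ maximalIdeal R :=
      sup_le ((Ideal.span_singleton_le_iff_mem _).2 ham) hle
    obtain ⟨us, hul, huI, hu⟩ := exists_isWeaklyRegular_cons (Ideal.span {a} ⊔ Ideal.ofList as)
      hI n M (x :: rs₀) hrs hrI hreg (a + s)
      (add_mem (Ideal.mem_sup_left (Ideal.mem_span_singleton_self a)) (Ideal.mem_sup_right hs)) hb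
    -- Modulo `a + s` the element `a` acts as `-s`, so every element of the full ideal acts as one
    -- of the ideal of the `n` remaining generators. This makes the induction hypothesis applicable.
    have hex : ∀ r ∈ Ideal.span {a} ⊔ Ideal.ofList as,
        ∃ t ∈ Ideal.ofList as, ∀ m : QuotSMulTop (a + s) M, r • m = t • m := by
      intro r hr
      obtain ⟨ca, hca, t, ht, rfl⟩ := Submodule.mem_sup.1 hr
      obtain ⟨c, rfl⟩ := Ideal.mem_span_singleton'.1 hca
      refine ⟨t - c * s, sub_mem ht (Ideal.mul_mem_left _ _ hs), fun m => ?_⟩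
      have h0 : (a + s) • m = 0 := by
        obtain ⟨m, rfl⟩ := Submodule.Quotient.mk_surjective _ m
        rw [← Submodule.Quotient.mk_smul, Submodule.Quotient.mk_eq_zero]
        exact Submodule.smul_mem_pointwise_smul _ _ _ trivial
      have : c * a + t = (t - c * s) + c * (a + s) := by ring
      rw [this, add_smul, mul_smul, h0, smul_zero, add_zero]
    choose! F hF hF' using hex
    rw [isWeaklyRegular_cons_iff] at hu
    have hu' : IsWeaklyRegular (QuotSMulTop (a + s) M) (us.map F) := by
      refine (isWeaklyRegular_of_smul_eq ?_).1 hu.2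
      rw [List.forall₂_map_right_iff, List.forall₂_same]
      exact fun r hr => hF' r (huI r hr)
    have hb' : IsWeaklyRegular M ((a + s) :: as) := by
      refine (ih (QuotSMulTop (a + s) M) as (us.map F) hlen (by simpa using hul) hm' ?_ hu').cons hb
      intro r hr
      obtain ⟨u, hu, rfl⟩ := List.mem_map.1 hr
      exact hF u (huI u hu)
    -- With the modified generator in last position, `a + s` and `a` act identically on the quotient
    -- by the others.
    rw [isWeaklyRegular_snoc hbm hm'] at hb'
    rw [isWeaklyRegular_snoc ham hm']
    refine ⟨hb'.1, ?_⟩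
    have h1 := hb'.2
    rw [isSMulRegular_quotient_iff_mem_of_smul_mem] at h1 ⊢
    refine fun m hmem => h1 m ?_
    rw [add_smul]
    exact add_mem hmem (Submodule.smul_mem_smul hs trivial)

end RegularSequenceExchange

/-! ### The weighted order filtration and homogeneous components. -/

namespace MvPowerSeries

open Finsupp

section OrderIdeal

variable {σ K : Type*} [Field K] (w : σ → ℕ)

/-- The ideal of power series of weighted order at least `e`. -/
def orderIdeal (e : ℕ) : Ideal (MvPowerSeries σ K) where
  carrier := {h | (e : ℕ∞) ≤ h.weightedOrder w}
  zero_mem' := by simp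
  add_mem' ha hb := (le_min ha hb).trans (min_weightedOrder_le_add w)
  smul_mem' c h hh := by
    refine le_trans ?_ (le_weightedOrder_mul w)
    exact le_add_of_nonneg_of_le zero_le hh

variable {w}

theorem mem_orderIdeal {e : ℕ} {h : MvPowerSeries σ K} :
    h ∈ orderIdeal w e ↔ ∀ α, weight w α < e → coeff α h = 0 := by
  constructor
  · intro hh α hα
    exact coeff_eq_zero_of_lt_weightedOrder w (lt_of_lt_of_le (by exact_mod_cast hα) hh)
  · intro hh
    exact nat_le_weightedOrder w hh

theorem orderIdeal_zero : orderIdeal (K := K) w 0 = ⊤ := by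
  rw [Ideal.eq_top_iff_one, mem_orderIdeal]
  exact fun α h => absurd h (Nat.not_lt_zero _)

theorem mem_orderIdeal_zero (h : MvPowerSeries σ K) : h ∈ orderIdeal w 0 := by
  rw [orderIdeal_zero]; trivial

theorem orderIdeal_anti {a b : ℕ} (hab : a ≤ b) :
    orderIdeal (K := K) w b ≤ orderIdeal w a := by
  intro h hh
  rw [mem_orderIdeal] at hh ⊢
  exact fun α hα => hh α (hα.trans_le hab)

theorem mul_mem_orderIdeal {a b : ℕ} {f g : MvPowerSeries σ K} (hf : f ∈ orderIdeal w a)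
    (hg : g ∈ orderIdeal w b) : f * g ∈ orderIdeal w (a + b) := by
  change ((a + b : ℕ) : ℕ∞) ≤ _
  push_cast
  exact (add_le_add hf hg).trans (le_weightedOrder_mul w)

theorem mem_orderIdeal_of_isWeightedHomogeneous {f : MvPowerSeries σ K} {d e : ℕ}
    (hf : f.IsWeightedHomogeneous w d) (he : e ≤ d) : f ∈ orderIdeal w e := by
  rw [mem_orderIdeal]
  exact fun α hα => hf.coeff_eq_zero (by omega)

theorem mem_orderIdeal_succ {e : ℕ} {h : MvPowerSeries σ K} :
    h ∈ orderIdeal w (e + 1) ↔ h ∈ orderIdeal w e ∧ weightedHomogeneousComponent w e h = 0 := by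
  simp only [mem_orderIdeal, Nat.lt_succ_iff_lt_or_eq, MvPowerSeries.ext_iff,
    coeff_weightedHomogeneousComponent, map_zero, ite_eq_right_iff]
  exact ⟨fun H => ⟨fun α h => H α (.inl h), fun α h => H α (.inr h)⟩,
    fun H α h => h.elim (H.1 α) (H.2 α)⟩

theorem sub_weightedHomogeneousComponent_mem {e : ℕ} {h : MvPowerSeries σ K}
    (hh : h ∈ orderIdeal w e) : h - weightedHomogeneousComponent w e h ∈ orderIdeal w (e + 1) := by
  rw [mem_orderIdeal] at hh ⊢
  intro α hα
  rw [map_sub, coeff_weightedHomogeneousComponent]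
  split_ifs with h1
  · simp
  · rw [hh α (by omega), sub_zero]

theorem weightedHomogeneousComponent_monomial (e : ℕ) (α : σ →₀ ℕ) (c : K) :
    weightedHomogeneousComponent w e (monomial α c) =
      if weight w α = e then monomial α c else 0 := by
  classical
  ext β
  rw [coeff_weightedHomogeneousComponent]
  by_cases hβ : β = α
  · subst hβ
    split_ifs <;> simp
  · split_ifs <;> simp [coeff_monomial_ne hβ]

/-- Homogeneous of degree `e - d`, and zero if `e < d`. -/
def IsHomogeneousShift (w : σ → ℕ) (e d : ℕ) (a : MvPowerSeries σ K) : Prop :=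
  ∀ α, coeff α a ≠ 0 → weight w α + d = e

/-- The part of `a` of weighted degree `e - d`, zero if `e < d`. -/
noncomputable def shiftComponent (w : σ → ℕ) (e d : ℕ) (a : MvPowerSeries σ K) : MvPowerSeries σ K :=
  if d ≤ e then weightedHomogeneousComponent w (e - d) a else 0

theorem isHomogeneousShift_shiftComponent (e d : ℕ) (a : MvPowerSeries σ K) :
    IsHomogeneousShift w e d (shiftComponent w e d a) := by
  intro α hα
  rw [shiftComponent] at hα
  split_ifs at hα with h
  · have := isWeightedHomogeneous_weightedHomogeneousComponent w a (e - d) hα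
    omega
  · simp at hα

theorem IsHomogeneousShift.isWeightedHomogeneous {e d : ℕ} {a : MvPowerSeries σ K}
    (ha : IsHomogeneousShift w e d a) : a.IsWeightedHomogeneous w (e - d) := by
  intro α hα
  have := ha α hα
  omega

theorem IsHomogeneousShift.mul_mem_orderIdeal {e d k : ℕ} {a g : MvPowerSeries σ K}
    (ha : IsHomogeneousShift w e d a) (hg : g ∈ orderIdeal w (d + k)) :
    a * g ∈ orderIdeal w (e + k) := by
  by_cases hd : d ≤ e
  · have := MvPowerSeries.mul_mem_orderIdeal 
      (mem_orderIdeal_of_isWeightedHomogeneous ha.isWeightedHomogeneous le_rfl) hg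
    rwa [show e - d + (d + k) = e + k by omega] at this
  · have : a = 0 := by
      ext α
      by_contra hne
      have := ha α hne
      omega
    rw [this, zero_mul]
    exact zero_mem _

/-- Only the part of `a` of degree `e - d` can contribute in degree `e`. For `e < d` nothing does,
which is why `shiftComponent` replaces truncated subtraction. -/
theorem weightedHomogeneousComponent_mul {d e : ℕ} {G : MvPowerSeries σ K}
    (hG : G.IsWeightedHomogeneous w d) (a : MvPowerSeries σ K) :
    weightedHomogeneousComponent w e (a * G) = shiftComponent w e d a * G := by
  classical
  have hR : (shiftComponent w e d a * G).IsWeightedHomogeneous w e := by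
    intro α hα
    by_contra hne
    apply hα
    rw [coeff_mul]
    refine Finset.sum_eq_zero fun x hx => ?_
    by_contra h0
    have h1 := isHomogeneousShift_shiftComponent e d a x.1 (left_ne_zero_of_mul h0)
    have h2 := hG (right_ne_zero_of_mul h0)
    rw [Finset.HasAntidiagonal.mem_antidiagonal] at hx
    rw [← hx, map_add] at hne
    omega
  ext α
  rw [coeff_weightedHomogeneousComponent]
  split_ifs with hα
  · rw [coeff_mul, coeff_mul]
    refine Finset.sum_congr rfl fun x hx => ?_
    rw [Finset.HasAntidiagonal.mem_antidiagonal] at hx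
    by_cases h2 : coeff x.2 G = 0
    · rw [h2, mul_zero, mul_zero]
    · have h2' := hG h2
      rw [← hx, map_add] at hα
      rw [shiftComponent, if_pos (by omega), coeff_weightedHomogeneousComponent,
        if_pos (by omega)]
  · exact (hR.coeff_eq_zero hα).symm

/-- Truncation is harmless here: for `e < d` the conclusion only asks for order at least `0`. -/
theorem sub_shiftComponent_mem {e d : ℕ} {a : MvPowerSeries σ K}
    (ha : a ∈ orderIdeal w (e - d)) :
    a - shiftComponent w e d a ∈ orderIdeal w (e + 1 - d) := by
  rw [shiftComponent]
  split_ifs with h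
  · rw [show e + 1 - d = e - d + 1 by omega]
    exact sub_weightedHomogeneousComponent_mem ha
  · rw [show e + 1 - d = 0 by omega]
    exact mem_orderIdeal_zero _

theorem mem_span_image_finset {ι R : Type*} [CommRing R] {s : Finset ι} {G : ι → R} {h : R} :
    h ∈ Ideal.span (G '' s) ↔ ∃ a : ι → R, ∑ i ∈ s, a i * G i = h := by
  classical
  constructor
  · intro hh
    obtain ⟨c, rfl⟩ := (Submodule.mem_span_image_finset_iff_exists_fun R).1 hh
    refine ⟨fun i => if hi : i ∈ s then c ⟨i, hi⟩ else 0, ?_⟩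
    rw [← Finset.sum_coe_sort]
    simp
  · rintro ⟨a, rfl⟩
    exact sum_mem fun i hi => Ideal.mul_mem_left _ _
      (Ideal.subset_span (Set.mem_image_of_mem _ hi))

/-- A homogeneous element of an ideal with homogeneous generators is a combination of the
generators with homogeneous coefficients. -/
theorem exists_homogeneous_combination {ι : Type*} {s : Finset ι} {G : ι → MvPowerSeries σ K}
    {d : ι → ℕ} (hG : ∀ i ∈ s, (G i).IsWeightedHomogeneous w (d i)) {e : ℕ}
    {h : MvPowerSeries σ K} (hh : h.IsWeightedHomogeneous w e) (hmem : h ∈ Ideal.span (G '' s)) :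
    ∃ a : ι → MvPowerSeries σ K, (∀ i, IsHomogeneousShift w e (d i) (a i)) ∧
      ∑ i ∈ s, a i * G i = h := by
  obtain ⟨b, rfl⟩ := mem_span_image_finset.1 hmem
  refine ⟨fun i => shiftComponent w e (d i) (b i),
    fun i => isHomogeneousShift_shiftComponent _ _ _, ?_⟩
  rw [isWeightedHomogeneous_iff_eq_weightedHomogeneousComponent.1 hh, map_sum]
  exact Finset.sum_congr rfl fun i hi => (weightedHomogeneousComponent_mul (hG i hi) _).symm

/-- An ideal with homogeneous generators contains the components of its elements. -/
theorem weightedHomogeneousComponent_mem_span {ι : Type*} {s : Finset ι}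
    {G : ι → MvPowerSeries σ K} {d : ι → ℕ}
    (hG : ∀ i ∈ s, (G i).IsWeightedHomogeneous w (d i)) (e : ℕ)
    {h : MvPowerSeries σ K} (hmem : h ∈ Ideal.span (G '' s)) :
    weightedHomogeneousComponent w e h ∈ Ideal.span (G '' s) := by
  obtain ⟨b, rfl⟩ := mem_span_image_finset.1 hmem
  rw [map_sum]
  refine sum_mem fun i hi => ?_
  rw [weightedHomogeneousComponent_mul (hG i hi)]
  exact Ideal.mul_mem_left _ _ (Ideal.subset_span (Set.mem_image_of_mem _ hi))

/-- Lifting of a homogeneous element along generators with given initial forms. -/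
theorem exists_lift_of_isWeightedHomogeneous {ι : Type*} {s : Finset ι}
    {G g : ι → MvPowerSeries σ K} {d : ι → ℕ}
    (hG : ∀ i ∈ s, (G i).IsWeightedHomogeneous w (d i))
    (hg : ∀ i ∈ s, g i - G i ∈ orderIdeal w (d i + 1)) {e : ℕ}
    {h : MvPowerSeries σ K} (hh : h.IsWeightedHomogeneous w e) (hmem : h ∈ Ideal.span (G '' s)) :
    ∃ a : ι → MvPowerSeries σ K, (∀ i, IsHomogeneousShift w e (d i) (a i)) ∧
      h - ∑ i ∈ s, a i * g i ∈ orderIdeal w (e + 1) := by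
  obtain ⟨a, ha, rfl⟩ := exists_homogeneous_combination hG hh hmem
  refine ⟨a, ha, ?_⟩
  rw [← Finset.sum_sub_distrib]
  refine sum_mem fun i hi => ?_
  rw [← neg_sub, ← mul_sub]
  exact neg_mem ((ha i).mul_mem_orderIdeal (hg i hi))

end OrderIdeal

/-! ### Ideals generated by powers of the variables. -/

section MonomialIdeal

variable {σ K : Type*} [Field K]

/-- The power series with monomials `x ^ α` such that `N ≤ α i` for some `i ∈ s` are the elements
of the ideal `⟨x_i ^ N | i ∈ s⟩`. -/
theorem mem_span_X_pow {s : Set σ} (hs : s.Finite) {N : ℕ} {h : MvPowerSeries σ K} :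
    h ∈ Ideal.span ((fun i => (X i : MvPowerSeries σ K) ^ N) '' s) ↔
      ∀ α, coeff α h ≠ 0 → ∃ i ∈ s, N ≤ α i := by
  classical
  lift s to Finset σ using hs
  constructor
  · intro hh
    induction hh using Submodule.span_induction with
    | mem x hx =>
      obtain ⟨i, hi, rfl⟩ := hx
      intro α hα
      simp only [coeff_X_pow, ne_eq, ite_eq_right_iff, one_ne_zero, imp_false, not_not] at hα
      exact ⟨i, hi, by simp [hα]⟩
    | zero => simp
    | add x y _ _ hx hy =>
      intro α hα
      by_cases h0 : coeff α x = 0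
      · exact hy α fun h1 => hα (by rw [map_add, h0, h1, add_zero])
      · exact hx α h0
    | smul c x _ hx =>
      intro α hα
      rw [smul_eq_mul, coeff_mul] at hα
      obtain ⟨p, hp, hne⟩ := Finset.exists_ne_zero_of_sum_ne_zero hα
      obtain ⟨i, hi, hN⟩ := hx p.2 (right_ne_zero_of_mul hne)
      refine ⟨i, hi, hN.trans ?_⟩
      rw [Finset.HasAntidiagonal.mem_antidiagonal] at hp
      simp [← hp]
  · induction s using Finset.induction_on generalizing h with
    | empty =>
      intro hh
      have : h = 0 := by
        ext α
        by_contra hne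
        simpa using hh α hne
      rw [this]; exact zero_mem _
    | insert i s _ ih =>
      intro hh
      -- `h₁` collects the terms divisible by `x_i ^ N`; the remaining terms are handled by the
      -- smaller set.
      let h₁ : MvPowerSeries σ K := fun α => if N ≤ α i then coeff α h else 0
      have hc : ∀ α, coeff α h₁ = if N ≤ α i then coeff α h else 0 := fun α => rfl
      have h1 : X i ^ N ∣ h₁ := by
        rw [X_pow_dvd_iff]
        intro m hm
        rw [hc, if_neg (by omega)]
      have h2 : h - h₁ ∈ Ideal.span ((fun i => (X i : MvPowerSeries σ K) ^ N) '' s) := by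
        apply ih
        intro α hα
        rw [map_sub, hc] at hα
        split_ifs at hα with hN
        · simp at hα
        · rw [sub_zero] at hα
          obtain ⟨j, hj, hjN⟩ := hh α hα
          rcases Finset.mem_insert.1 (Finset.mem_coe.1 hj) with rfl | hj
          · exact absurd hjN hN
          · exact ⟨j, hj, hjN⟩
      rw [← sub_add_cancel h h₁]
      refine add_mem (Ideal.span_mono (Set.image_mono (by simp)) h2) ?_
      exact Ideal.mem_of_dvd _ h1
        (Ideal.subset_span (Set.mem_image_of_mem _ (Finset.mem_coe.2 (Finset.mem_insert_self _ _))))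

/-- Multiplication by `x_i ^ N` changes only the `i`-th exponent, and `i ∉ s`. This is the
regularity of the sequence of powers of the variables. -/
theorem mem_span_X_pow_of_X_pow_mul_mem {s : Set σ} (hs : s.Finite) {N : ℕ} {i : σ} (hi : i ∉ s)
    {h : MvPowerSeries σ K}
    (hh : X i ^ N * h ∈ Ideal.span ((fun i => (X i : MvPowerSeries σ K) ^ N) '' s)) :
    h ∈ Ideal.span ((fun i => (X i : MvPowerSeries σ K) ^ N) '' s) := by
  classical
  rw [mem_span_X_pow hs] at hh ⊢
  intro α hα
  obtain ⟨j, hj, hN⟩ := hh (single i N + α) (by rwa [X_pow_eq, coeff_add_monomial_mul, one_mul])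
  refine ⟨j, hj, ?_⟩
  rwa [Finsupp.add_apply, single_eq_of_ne (by rintro rfl; exact hi hj), zero_add] at hN

variable [Finite σ]

/-- In the Artinian quotient the powers of `x_i` stabilise, so `x_i ^ N (1 - x_i y) ∈ I`, and the
second factor is a unit. -/
theorem exists_X_pow_mem (I : Ideal (MvPowerSeries σ K)) [Module.Finite K (MvPowerSeries σ K ⧸ I)] :
    ∃ N, ∀ i, (X i : MvPowerSeries σ K) ^ N ∈ I := by
  have hart : IsArtinian (MvPowerSeries σ K) (MvPowerSeries σ K ⧸ I) :=
    isArtinian_of_tower K inferInstance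
  have h1 : ∀ i : σ, ∃ N, (X i : MvPowerSeries σ K) ^ N ∈ I := by
    intro i
    obtain ⟨N, y, hy⟩ := IsArtinian.exists_pow_succ_smul_dvd (X i : MvPowerSeries σ K)
      (1 : MvPowerSeries σ K ⧸ I)
    obtain ⟨y, rfl⟩ := Ideal.Quotient.mk_surjective y
    refine ⟨N, ?_⟩
    have hy' : (X i : MvPowerSeries σ K) ^ N * (1 - X i * y) ∈ I := by
      rw [← Ideal.Quotient.eq_zero_iff_mem]
      have hy : Ideal.Quotient.mk I (X i ^ (N + 1) * y) = Ideal.Quotient.mk I (X i ^ N * 1) := hy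
      rw [show X i ^ N * (1 - X i * y) = X i ^ N * 1 - X i ^ (N + 1) * y by ring, map_sub, hy,
        sub_self]
    have hu : IsUnit (1 - X i * y : MvPowerSeries σ K) := by
      rw [isUnit_iff_constantCoeff]; simp
    exact (Ideal.mul_unit_mem_iff_mem _ hu).1 hy'
  choose N hN using h1
  have := Fintype.ofFinite σ
  exact ⟨∑ i, N i, fun i => Ideal.pow_mem_of_pow_mem _ (hN i)
    (Finset.single_le_sum (fun _ _ => Nat.zero_le _) (Finset.mem_univ i))⟩

/-- A monomial whose exponents are all below `N` has weight at most `N * ∑ i, w i`. -/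
theorem orderIdeal_le_span_X_pow [Fintype σ] (w : σ → ℕ) (N : ℕ) :
    orderIdeal (K := K) w (N * ∑ i, w i + 1) ≤
      Ideal.span ((fun i => (X i : MvPowerSeries σ K) ^ N) '' Set.univ) := by
  intro h hh
  rw [mem_span_X_pow Set.finite_univ]
  rw [mem_orderIdeal] at hh
  intro α hα
  by_contra! hcon
  refine hα (hh α (Nat.lt_succ_of_le ?_))
  rw [weight_apply, Finsupp.sum_fintype _ _ (by simp), Finset.mul_sum]
  exact Finset.sum_le_sum fun i _ => Nat.mul_le_mul_right _ (hcon i trivial).le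

/-- Every power series is a constant plus an element of the ideal generated by the variables. -/
theorem sub_C_constantCoeff_mem (h : MvPowerSeries σ K) :
    h - C (constantCoeff h) ∈ Ideal.span (Set.range fun i => (X i : MvPowerSeries σ K)) := by
  classical
  have := mem_span_X_pow (K := K) (s := (Set.univ : Set σ)) Set.finite_univ (N := 1)
    (h := h - C (constantCoeff h))
  simp only [pow_one, Set.image_univ] at this
  rw [this]
  intro α hα
  by_contra! hcon
  have : α = 0 := by
    ext i
    have := hcon i trivial
    simpa using this
  subst this
  simp at hα

theorem maximalIdeal_eq_span :
    IsLocalRing.maximalIdeal (MvPowerSeries σ K) =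
      Ideal.span (Set.range fun i => (X i : MvPowerSeries σ K)) := by
  apply le_antisymm
  · intro h hh
    have h0 : constantCoeff h = 0 := by
      by_contra hne
      exact hh (isUnit_iff_constantCoeff.2 (isUnit_iff_ne_zero.2 hne))
    have := sub_C_constantCoeff_mem h
    rwa [h0, map_zero, sub_zero] at this
  · rw [Ideal.span_le]
    rintro _ ⟨i, rfl⟩
    exact fun hu => not_isUnit_zero (constantCoeff_X (R := K) i ▸ hu.map constantCoeff)

end MonomialIdeal

end MvPowerSeries

namespace MvPowerSeries

open Finsupp

/-! ### Lifting spanning monomials from leading forms. -/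

section Spanning

variable {σ K ι : Type*} [Field K] [Fintype σ] {w : σ → ℕ} {s : Finset ι}
  {G g : ι → MvPowerSeries σ K} {d : ι → ℕ}

theorem exists_orderIdeal_le (w : σ → ℕ) (I : Ideal (MvPowerSeries σ K))
    [Module.Finite K (MvPowerSeries σ K ⧸ I)] : ∃ c, orderIdeal w c ≤ I := by
  obtain ⟨N, hN⟩ := exists_X_pow_mem I
  refine ⟨_, (orderIdeal_le_span_X_pow w N).trans (Ideal.span_le.2 ?_)⟩
  rintro _ ⟨i, -, rfl⟩
  exact hN i

-- From order `c` on, every homogeneous component lies in `⟨G i⟩` and can be cancelled by a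
-- combination of the `g i`. Only approximations are produced; Nakayama's lemma will replace passage
-- to a limit.
omit [Fintype σ] in
theorem exists_mem_sub_mem_orderIdeal {J : Ideal (MvPowerSeries σ K)}
    (hG : ∀ i ∈ s, (G i).IsWeightedHomogeneous w (d i))
    (hg : ∀ i ∈ s, g i - G i ∈ orderIdeal w (d i + 1)) (hJ : ∀ i ∈ s, g i ∈ J) {c : ℕ}
    (hc : orderIdeal w c ≤ Ideal.span (G '' s)) {h : MvPowerSeries σ K}
    (hh : h ∈ orderIdeal w c) (k : ℕ) : ∃ j ∈ J, h - j ∈ orderIdeal w (c + k) := by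
  induction k with
  | zero => exact ⟨0, zero_mem _, by simpa using hh⟩
  | succ k ih =>
    obtain ⟨j, hj, hjm⟩ := ih
    obtain ⟨a, -, ha⟩ := exists_lift_of_isWeightedHomogeneous hG hg
      (isWeightedHomogeneous_weightedHomogeneousComponent w (h - j) (c + k))
      (hc (mem_orderIdeal_of_isWeightedHomogeneous
        (isWeightedHomogeneous_weightedHomogeneousComponent w (h - j) (c + k)) (by omega)))
    refine ⟨j + ∑ i ∈ s, a i * g i,
      add_mem hj (sum_mem fun i hi => Ideal.mul_mem_left _ _ (hJ i hi)), ?_⟩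
    have := add_mem (sub_weightedHomogeneousComponent_mem hjm) ha
    rw [← add_assoc]
    convert! this using 1
    ring

/-- If the initial forms `G i` generate an ideal of finite colength, then so do the `g i`, and the
ideal they generate contains all power series of large order. -/
theorem exists_orderIdeal_le_of_initialForms (hw : ∀ i, 0 < w i) {J : Ideal (MvPowerSeries σ K)}
    (hG : ∀ i ∈ s, (G i).IsWeightedHomogeneous w (d i))
    (hg : ∀ i ∈ s, g i - G i ∈ orderIdeal w (d i + 1)) (hJ : ∀ i ∈ s, g i ∈ J)
    [Module.Finite K (MvPowerSeries σ K ⧸ Ideal.span (G '' s))] :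
    ∃ c, orderIdeal w c ≤ J := by
  obtain ⟨c, hc⟩ := exists_orderIdeal_le w (Ideal.span (G '' s))
  set Q : Ideal (MvPowerSeries σ K) := Ideal.span ((fun i => X i ^ c) '' Set.univ) with hQ
  have hQJ : Q ≤ J ⊔ IsLocalRing.maximalIdeal (MvPowerSeries σ K) • Q := by
    rw [hQ, Ideal.span_le, ← hQ]
    rintro _ ⟨i, -, rfl⟩
    have hi : (X i : MvPowerSeries σ K) ^ c ∈ orderIdeal w c := by
      classical
      rw [mem_orderIdeal]
      intro α hα
      rw [coeff_X_pow, if_neg]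
      rintro rfl
      rw [weight_single, smul_eq_mul] at hα
      exact absurd hα (not_lt.2 (Nat.le_mul_of_pos_right c (hw i)))
    -- The order is chosen so that the remainder falls into `⟨x_i ^ (c + 1)⟩`, hence into the
    -- maximal ideal times `Q`.
    obtain ⟨j, hj, hjm⟩ := exists_mem_sub_mem_orderIdeal hG hg hJ hc hi ((c + 1) * ∑ i, w i + 1)
    change X i ^ c ∈ J ⊔ _
    rw [← add_sub_cancel j ((X i : MvPowerSeries σ K) ^ c)]
    refine add_mem (Ideal.mem_sup_left hj) (Ideal.mem_sup_right ?_)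
    have h2 : Ideal.span ((fun i => (X i : MvPowerSeries σ K) ^ (c + 1)) '' Set.univ) ≤
        IsLocalRing.maximalIdeal (MvPowerSeries σ K) • Q := by
      rw [Ideal.span_le]
      rintro _ ⟨i, -, rfl⟩
      change X i ^ (c + 1) ∈ _
      rw [pow_succ']
      refine Submodule.smul_mem_smul ?_ (Ideal.subset_span ⟨i, trivial, rfl⟩)
      rw [maximalIdeal_eq_span]
      exact Ideal.subset_span ⟨i, rfl⟩
    exact h2 (orderIdeal_le_span_X_pow w (c + 1) (orderIdeal_anti (by omega) hjm))
  have hQ' : Q ≤ J := Submodule.le_of_le_smul_of_le_jacobson_bot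
    (Submodule.fg_span ((Set.finite_univ).image _))
    (IsLocalRing.maximalIdeal_le_jacobson ⊥) hQJ
  exact ⟨_, (orderIdeal_le_span_X_pow w c).trans hQ'⟩

omit [Fintype σ] in
theorem weightedHomogeneousComponent_mem_span_monomial {κ : Type*} (b : κ → σ →₀ ℕ) (e : ℕ)
    {v : MvPowerSeries σ K} (hv : v ∈ Submodule.span K (Set.range fun k => monomial (b k) (1 : K))) :
    weightedHomogeneousComponent w e v ∈
      Submodule.span K (Set.range fun k => monomial (b k) (1 : K)) := by
  induction hv using Submodule.span_induction with
  | mem x hx =>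
    obtain ⟨k, rfl⟩ := hx
    simp only [weightedHomogeneousComponent_monomial]
    split_ifs
    · exact Submodule.subset_span ⟨k, rfl⟩
    · exact zero_mem _
  | zero => simp
  | add x y _ _ hx hy => rw [map_add]; exact add_mem hx hy
  | smul c x _ hx => rw [map_smul]; exact Submodule.smul_mem _ _ hx

/-- In each degree, the leading component is a combination of the monomials plus an element of `⟨G
i⟩` that lifts to `J`. Finitely many rounds suffice, since `J` contains everything of large order.
Regularity plays no role. -/
theorem exists_span_sub_mem_of_initialForms (hw : ∀ i, 0 < w i) {J : Ideal (MvPowerSeries σ K)}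
    (hG : ∀ i ∈ s, (G i).IsWeightedHomogeneous w (d i))
    (hg : ∀ i ∈ s, g i - G i ∈ orderIdeal w (d i + 1)) (hJ : ∀ i ∈ s, g i ∈ J)
    [Module.Finite K (MvPowerSeries σ K ⧸ Ideal.span (G '' s))] {κ : Type*} (b : κ → σ →₀ ℕ)
    (hb : ∀ h : MvPowerSeries σ K,
      ∃ v ∈ Submodule.span K (Set.range fun k => monomial (b k) (1 : K)),
        h - v ∈ Ideal.span (G '' s)) (h : MvPowerSeries σ K) :
    ∃ v ∈ Submodule.span K (Set.range fun k => monomial (b k) (1 : K)), h - v ∈ J := by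
  have key : ∀ e : ℕ, ∃ v ∈ Submodule.span K (Set.range fun k => monomial (b k) (1 : K)),
      ∃ j ∈ J, h - v - j ∈ orderIdeal w e := by
    intro e
    induction e with
    | zero => exact ⟨0, zero_mem _, 0, zero_mem _, mem_orderIdeal_zero _⟩
    | succ e ih =>
      obtain ⟨v, hv, j, hj, hvj⟩ := ih
      obtain ⟨u, hu, hui⟩ := hb (weightedHomogeneousComponent w e (h - v - j))
      obtain ⟨a, -, ha⟩ := exists_lift_of_isWeightedHomogeneous hG hg
        (isWeightedHomogeneous_weightedHomogeneousComponent w _ e)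
        (weightedHomogeneousComponent_mem_span hG e hui)
      rw [map_sub, ← isWeightedHomogeneous_iff_eq_weightedHomogeneousComponent.1
        (isWeightedHomogeneous_weightedHomogeneousComponent w _ e)] at ha
      refine ⟨v + weightedHomogeneousComponent w e u,
        add_mem hv (weightedHomogeneousComponent_mem_span_monomial b e hu), j + ∑ i ∈ s, a i * g i,
        add_mem hj (sum_mem fun i hi => Ideal.mul_mem_left _ _ (hJ i hi)), ?_⟩
      have := add_mem (sub_weightedHomogeneousComponent_mem hvj) ha
      convert! this using 1
      ring
  obtain ⟨c, hc⟩ := exists_orderIdeal_le_of_initialForms hw hG hg hJ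
  obtain ⟨v, hv, j, hj, hvj⟩ := key c
  exact ⟨v, hv, by simpa using add_mem (hc hvj) hj⟩

omit [Fintype σ] in
theorem span_mk_monomial_eq_top_iff (I : Ideal (MvPowerSeries σ K)) {κ : Type*} (b : κ → σ →₀ ℕ) :
    Submodule.span K (Set.range fun k => Ideal.Quotient.mk I (monomial (b k) (1 : K))) = ⊤ ↔
      ∀ h : MvPowerSeries σ K,
        ∃ v ∈ Submodule.span K (Set.range fun k => monomial (b k) (1 : K)), h - v ∈ I := by
  have hmap : Submodule.span K (Set.range fun k => Ideal.Quotient.mk I (monomial (b k) (1 : K))) =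
      (Submodule.span K (Set.range fun k => monomial (b k) (1 : K))).map
        (Ideal.Quotient.mkₐ K I).toLinearMap := by
    rw [Submodule.map_span, ← Set.range_comp]
    rfl
  rw [hmap, Submodule.eq_top_iff']
  constructor
  · intro H h
    obtain ⟨v, hv, hvh⟩ := H (Ideal.Quotient.mk I h)
    exact ⟨v, hv, Ideal.Quotient.eq.1 hvh.symm⟩
  · intro H h
    obtain ⟨h, rfl⟩ := Ideal.Quotient.mk_surjective h
    obtain ⟨v, hv, hvh⟩ := H h
    exact ⟨v, hv, (Ideal.Quotient.eq.2 hvh).symm⟩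

/-- Monomials span the quotient because truncating at exponent `N` discards only elements of `⟨x_i ^
N⟩ ⊆ I`; a basis is then extracted from them. -/
theorem exists_monomial_basis (I : Ideal (MvPowerSeries σ K))
    [Module.Finite K (MvPowerSeries σ K ⧸ I)] :
    ∃ (m : ℕ) (b : Fin m → σ →₀ ℕ),
      LinearIndependent K (fun k => Ideal.Quotient.mk I (monomial (b k) (1 : K))) ∧
      ∀ h : MvPowerSeries σ K,
        ∃ v ∈ Submodule.span K (Set.range fun k => monomial (b k) (1 : K)), h - v ∈ I := by
  classical
  obtain ⟨κ, a, -, hspan, hli⟩ := exists_linearIndependent' K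
    (fun α : σ →₀ ℕ => Ideal.Quotient.mk I (monomial α (1 : K)))
  have : Finite κ := hli.finite
  have := Fintype.ofFinite κ
  refine ⟨Fintype.card κ, a ∘ (Fintype.equivFin κ).symm,
    hli.comp _ (Fintype.equivFin κ).symm.injective, ?_⟩
  rw [← span_mk_monomial_eq_top_iff]
  have hr : (Set.range fun k => Ideal.Quotient.mk I
      (monomial ((a ∘ (Fintype.equivFin κ).symm) k) (1 : K))) =
      Set.range ((fun α : σ →₀ ℕ => Ideal.Quotient.mk I (monomial α (1 : K))) ∘ a) :=
    (Fintype.equivFin κ).symm.surjective.range_comp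
      ((fun α : σ →₀ ℕ => Ideal.Quotient.mk I (monomial α (1 : K))) ∘ a)
  rw [hr, hspan]
  refine (span_mk_monomial_eq_top_iff I id).2 fun h => ?_
  obtain ⟨N, hN⟩ := exists_X_pow_mem I
  refine ⟨(trunc' K (equivFunOnFinite.symm fun _ => N) h : MvPolynomial σ K), ?_, ?_⟩
  · generalize trunc' K (equivFunOnFinite.symm fun _ => N) h = p
    induction p using MvPolynomial.induction_on' with
    | monomial u c =>
      rw [MvPolynomial.coe_monomial, show monomial u c = c • monomial u (1 : K) by
        rw [← map_smul, smul_eq_mul, mul_one]]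
      exact Submodule.smul_mem _ _ (Submodule.subset_span ⟨u, rfl⟩)
    | add p q hp hq => rw [MvPolynomial.coe_add]; exact add_mem hp hq
  · have hle : Ideal.span ((fun i => (X i : MvPowerSeries σ K) ^ N) '' Set.univ) ≤ I := by
      rw [Ideal.span_le]
      rintro _ ⟨i, -, rfl⟩
      exact hN i
    apply hle
    rw [mem_span_X_pow Set.finite_univ]
    intro α hα
    by_contra! hcon
    apply hα
    rw [map_sub, MvPolynomial.coeff_coe, coeff_trunc', if_pos, sub_self]
    exact fun i => (hcon i trivial).le

omit [Fintype σ] in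
theorem rank_eq_of_monomial_basis {I : Ideal (MvPowerSeries σ K)} {m : ℕ} {b : Fin m → σ →₀ ℕ}
    (hli : LinearIndependent K (fun k => Ideal.Quotient.mk I (monomial (b k) (1 : K))))
    (hb : ∀ h : MvPowerSeries σ K,
      ∃ v ∈ Submodule.span K (Set.range fun k => monomial (b k) (1 : K)), h - v ∈ I) :
    Module.rank K (MvPowerSeries σ K ⧸ I) = m := by
  rw [rank_eq_card_basis (Module.Basis.mk hli ((span_mk_monomial_eq_top_iff I b).2 hb).ge),
    Fintype.card_fin]

omit [Fintype σ] in
theorem rank_le_of_monomial_span {I : Ideal (MvPowerSeries σ K)} {m : ℕ} {b : Fin m → σ →₀ ℕ}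
    (hb : ∀ h : MvPowerSeries σ K,
      ∃ v ∈ Submodule.span K (Set.range fun k => monomial (b k) (1 : K)), h - v ∈ I) :
    Module.rank K (MvPowerSeries σ K ⧸ I) ≤ m := by
  have h1 := rank_span_le (R := K)
    (Set.range fun k => Ideal.Quotient.mk I (monomial (b k) (1 : K)))
  rw [(span_mk_monomial_eq_top_iff I b).2 hb, rank_top] at h1
  have h2 := Cardinal.mk_range_le_lift
    (f := fun k => Ideal.Quotient.mk I (monomial (b k) (1 : K)))
  simp only [Cardinal.mk_fin, Cardinal.lift_natCast, Cardinal.lift_id'] at h2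
  exact h1.trans (by simpa using h2)

end Spanning

/-! ### Regular sequences of leading forms and lifting of syzygies. -/

section RegularFamily

variable {σ K : Type*} [Field K] {w : σ → ℕ}

/-- The first `m` members of `G` form a weakly regular sequence. -/
def IsRegularFamily (G : ℕ → MvPowerSeries σ K) (m : ℕ) : Prop :=
  ∀ k < m, ∀ c, c * G k ∈ Ideal.span (G '' Finset.range k) → c ∈ Ideal.span (G '' Finset.range k)

theorem isRegularFamily_iff_isWeaklyRegular {G : ℕ → MvPowerSeries σ K} {m : ℕ} :
    IsRegularFamily G m ↔
      RingTheory.Sequence.IsWeaklyRegular (MvPowerSeries σ K) ((List.range m).map G) := by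
  rw [RingTheory.Sequence.isWeaklyRegular_iff]
  simp only [List.length_map, List.length_range]
  refine forall₂_congr fun k hk => ?_
  have h1 : Ideal.ofList (((List.range m).map G).take k) • (⊤ : Ideal (MvPowerSeries σ K)) =
      Ideal.span (G '' Finset.range k) := by
    rw [← List.map_take, List.take_range, min_eq_left hk.le, smul_eq_mul, Ideal.mul_top,
      Ideal.ofList]
    congr 1
    ext r
    simp
  rw [h1, isSMulRegular_quotient_iff_mem_of_smul_mem]
  simp [mul_comm]

variable {G g : ℕ → MvPowerSeries σ K} {d : ℕ → ℕ} {m : ℕ}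

theorem IsRegularFamily.mono (h : IsRegularFamily G m) {k : ℕ} (hk : k ≤ m) :
    IsRegularFamily G k :=
  fun j hj => h j (hj.trans_le hk)

/-- If the initial forms form a regular sequence, then a combination of high order of the `g i`
can be written with coefficients of high order. -/
theorem IsRegularFamily.exists_combination (hreg : IsRegularFamily G m)
    (hG : ∀ i < m, (G i).IsWeightedHomogeneous w (d i))
    (hg : ∀ i < m, g i - G i ∈ orderIdeal w (d i + 1)) (e : ℕ) (a : ℕ → MvPowerSeries σ K)
    (ha : ∑ i ∈ Finset.range m, a i * g i ∈ orderIdeal w e) :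
    ∃ a' : ℕ → MvPowerSeries σ K, (∀ i < m, a' i ∈ orderIdeal w (e - d i)) ∧
      ∑ i ∈ Finset.range m, a' i * g i = ∑ i ∈ Finset.range m, a i * g i := by
  induction m generalizing e a with
  | zero => exact ⟨a, by simp, by simp⟩
  | succ m ihm =>
    -- Inside the induction on the number of generators, the orders of the coefficients are raised
    -- one step at a time.
    induction e generalizing a with
    | zero => exact ⟨a, fun i _ => by rw [Nat.zero_sub]; exact mem_orderIdeal_zero _, rfl⟩
    | succ e ihe =>
      obtain ⟨b, hb, hba⟩ := ihe a (orderIdeal_anti (Nat.le_succ e) ha)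
      rw [← hba] at ha ⊢
      clear hba a
      have hterm : ∀ i < m + 1,
          b i * g i - shiftComponent w e (d i) (b i) * G i ∈ orderIdeal w (e + 1) := by
        intro i hi
        have h1 := mul_mem_orderIdeal (sub_shiftComponent_mem (hb i hi))
          (mem_orderIdeal_of_isWeightedHomogeneous (hG i hi) le_rfl)
        have h2 := mul_mem_orderIdeal (hb i hi) (hg i hi)
        have h3 := add_mem (orderIdeal_anti (show e + 1 ≤ e + 1 - d i + d i by omega) h1)
          (orderIdeal_anti (show e + 1 ≤ e - d i + (d i + 1) by omega) h2)
        convert! h3 using 1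
        ring
      -- The sum has order above `e`, so the leading parts of the coefficients form a syzygy of the
      -- `G i`.
      have hzero : ∑ i ∈ Finset.range (m + 1), shiftComponent w e (d i) (b i) * G i = 0 := by
        have h1 : ∑ i ∈ Finset.range (m + 1), shiftComponent w e (d i) (b i) * G i ∈
            orderIdeal w (e + 1) := by
          have h2 : ∑ i ∈ Finset.range (m + 1),
              (b i * g i - shiftComponent w e (d i) (b i) * G i) ∈ orderIdeal w (e + 1) :=
            sum_mem fun i hi => hterm i (Finset.mem_range.1 hi)
          rw [Finset.sum_sub_distrib] at h2
          simpa using sub_mem ha h2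
        have h3 := (mem_orderIdeal_succ.1 h1).2
        rw [map_sum] at h3
        rw [← h3]
        refine Finset.sum_congr rfl fun i hi => ?_
        rw [weightedHomogeneousComponent_mul (hG i (Finset.mem_range.1 hi))]
        congr 1
        by_cases hde : d i ≤ e
        · rw [shiftComponent, if_pos hde, shiftComponent, if_pos hde]
          exact isWeightedHomogeneous_iff_eq_weightedHomogeneousComponent.1
            (isWeightedHomogeneous_weightedHomogeneousComponent w _ _)
        · rw [shiftComponent, if_neg hde, shiftComponent, if_neg hde]
      -- By regularity the leading part of the last coefficient lies in the ideal of the earlier `G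
      -- i`; lifting it to the `g i` lets it be subtracted.
      obtain ⟨q, hq⟩ : ∃ q : ℕ → MvPowerSeries σ K,
          b m - ∑ i ∈ Finset.range m, q i * g i ∈ orderIdeal w (e + 1 - d m) := by
        by_cases hde : d m ≤ e
        · have hc : shiftComponent w e (d m) (b m) ∈ Ideal.span (G '' Finset.range m) := by
            apply hreg m (Nat.lt_succ_self m)
            rw [Finset.sum_range_succ, add_comm, add_eq_zero_iff_eq_neg] at hzero
            rw [hzero]
            exact neg_mem (mem_span_image_finset.2 ⟨_, rfl⟩)
          obtain ⟨q, -, hq⟩ := exists_lift_of_isWeightedHomogeneous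
            (fun i hi => hG i (Nat.lt_succ_of_lt (Finset.mem_range.1 hi)))
            (fun i hi => hg i (Nat.lt_succ_of_lt (Finset.mem_range.1 hi)))
            (isHomogeneousShift_shiftComponent e (d m) (b m)).isWeightedHomogeneous hc
          refine ⟨q, ?_⟩
          have := add_mem (sub_shiftComponent_mem (hb m (Nat.lt_succ_self m)))
            (orderIdeal_anti (show e + 1 - d m ≤ e - d m + 1 by omega) hq)
          convert! this using 1
          ring
        · refine ⟨0, ?_⟩
          rw [show e + 1 - d m = 0 by omega]
          exact mem_orderIdeal_zero _
      have hgm : g m ∈ orderIdeal w (d m) := by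
        have := add_mem (orderIdeal_anti (Nat.le_succ (d m)) (hg m (Nat.lt_succ_self m)))
          (mem_orderIdeal_of_isWeightedHomogeneous (hG m (Nat.lt_succ_self m)) le_rfl)
        simpa using this
      -- A Koszul correction: `q i * g i * g m` moves from the last summand to the `i`-th, leaving
      -- the total unchanged.
      have hsplit : ∑ i ∈ Finset.range m, (b i + q i * g m) * g i +
          (b m - ∑ i ∈ Finset.range m, q i * g i) * g m =
          ∑ i ∈ Finset.range (m + 1), b i * g i := by
        rw [Finset.sum_range_succ, sub_mul, Finset.sum_mul]
        simp only [add_mul, Finset.sum_add_distrib]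
        have : ∀ i, q i * g m * g i = q i * g i * g m := fun i => by ring
        simp only [this]
        ring
      have hrest : ∑ i ∈ Finset.range m, (b i + q i * g m) * g i ∈ orderIdeal w (e + 1) := by
        have h1 := orderIdeal_anti (show e + 1 ≤ e + 1 - d m + d m by omega)
          (mul_mem_orderIdeal hq hgm)
        rw [← hsplit] at ha
        simpa using sub_mem ha h1
      obtain ⟨a', ha', hsum⟩ := ihm (hreg.mono (Nat.le_succ m))
        (fun i hi => hG i (Nat.lt_succ_of_lt hi)) (fun i hi => hg i (Nat.lt_succ_of_lt hi))
        (e + 1) _ hrest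
      refine ⟨fun i => if i = m then b m - ∑ i ∈ Finset.range m, q i * g i else a' i, ?_, ?_⟩
      · intro i hi
        simp only
        split_ifs with him
        · rw [him]; exact hq
        · exact ha' i (by omega)
      · rw [← hsplit, ← hsum, Finset.sum_range_succ]
        simp only [if_true]
        congr 1
        refine Finset.sum_congr rfl fun i hi => ?_
        rw [if_neg (Finset.mem_range.1 hi).ne]

/-- If the initial forms `G i` form a regular sequence, then they generate the initial ideal. -/
theorem IsRegularFamily.weightedHomogeneousComponent_mem (hreg : IsRegularFamily G m)
    (hG : ∀ i < m, (G i).IsWeightedHomogeneous w (d i))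
    (hg : ∀ i < m, g i - G i ∈ orderIdeal w (d i + 1)) {e : ℕ} {h : MvPowerSeries σ K}
    (hh : h ∈ Ideal.span (g '' Finset.range m)) (he : h ∈ orderIdeal w e) :
    weightedHomogeneousComponent w e h ∈ Ideal.span (G '' Finset.range m) := by
  obtain ⟨a, rfl⟩ := mem_span_image_finset.1 hh
  obtain ⟨b, hb, hba⟩ := hreg.exists_combination hG hg e a he
  rw [← hba, map_sum]
  refine sum_mem fun i hi => ?_
  have hi' := Finset.mem_range.1 hi
  have h2 : b i * (g i - G i) ∈ orderIdeal w (e + 1) :=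
    orderIdeal_anti (by omega) (mul_mem_orderIdeal (hb i hi') (hg i hi'))
  rw [show b i * g i = b i * (g i - G i) + b i * G i by ring, map_add,
    (mem_orderIdeal_succ.1 h2).2, zero_add, weightedHomogeneousComponent_mul (hG i hi')]
  exact Ideal.mul_mem_left _ _ (Ideal.subset_span (Set.mem_image_of_mem _ hi))

theorem sum_smul_monomial_mem_iff (I : Ideal (MvPowerSeries σ K)) {κ : Type*} (t : Finset κ)
    (c : κ → K) (b : κ → σ →₀ ℕ) :
    ∑ k ∈ t, c k • Ideal.Quotient.mk I (monomial (b k) (1 : K)) = 0 ↔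
      ∑ k ∈ t, c k • monomial (b k) (1 : K) ∈ I := by
  rw [← Ideal.Quotient.eq_zero_iff_mem]
  change _ ↔ Ideal.Quotient.mkₐ K I _ = 0
  rw [map_sum]
  simp only [map_smul]
  rfl

/-- The part of least weight of a relation modulo the `g i` would be a nontrivial relation modulo
the `G i`. -/
theorem IsRegularFamily.linearIndependent (hreg : IsRegularFamily G m)
    (hG : ∀ i < m, (G i).IsWeightedHomogeneous w (d i))
    (hg : ∀ i < m, g i - G i ∈ orderIdeal w (d i + 1)) {κ : Type*} {b : κ → σ →₀ ℕ}
    (hli : LinearIndependent K fun k =>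
      Ideal.Quotient.mk (Ideal.span (G '' Finset.range m)) (monomial (b k) (1 : K))) :
    LinearIndependent K fun k =>
      Ideal.Quotient.mk (Ideal.span (g '' Finset.range m)) (monomial (b k) (1 : K)) := by
  classical
  rw [linearIndependent_iff'] at hli ⊢
  intro t c hc
  rw [sum_smul_monomial_mem_iff] at hc
  by_contra! hcon
  obtain ⟨k₀, hk₀, hmin⟩ := (t.filter fun k => c k ≠ 0).exists_min_image
    (fun k => weight w (b k)) (let ⟨k, hk, hne⟩ := hcon; ⟨k, Finset.mem_filter.2 ⟨hk, hne⟩⟩)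
  rw [Finset.mem_filter] at hk₀
  set e := weight w (b k₀)
  have hord : ∑ k ∈ t, c k • monomial (b k) (1 : K) ∈ orderIdeal w e := by
    refine sum_mem fun k hk => ?_
    by_cases hne : c k = 0
    · rw [hne, zero_smul]
      exact zero_mem _
    · rw [mem_orderIdeal]
      intro α hα
      have hlt : e ≤ weight w (b k) := hmin k (Finset.mem_filter.2 ⟨hk, hne⟩)
      rw [coeff_smul, coeff_monomial_ne (by rintro rfl; omega), mul_zero]
  have hmem := hreg.weightedHomogeneousComponent_mem hG hg hc hord
  have hcomp : weightedHomogeneousComponent w e (∑ k ∈ t, c k • monomial (b k) (1 : K)) =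
      ∑ k ∈ t, (if weight w (b k) = e then c k else 0) • monomial (b k) (1 : K) := by
    rw [map_sum]
    refine Finset.sum_congr rfl fun k _ => ?_
    rw [map_smul, weightedHomogeneousComponent_monomial, smul_ite, smul_zero, ite_smul, zero_smul]
  rw [hcomp, ← sum_smul_monomial_mem_iff] at hmem
  have := hli t _ hmem k₀ hk₀.1
  rw [if_pos rfl] at this
  exact hk₀.2 this

end RegularFamily

end MvPowerSeries

namespace MvPowerSeries

open Finsupp

/-! ### Hilbert functions of quotients by homogeneous regular sequences. -/

section HilbertSeries

variable {σ K : Type*} [Field K]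

/-- The space of weighted homogeneous power series of degree `e`. -/
noncomputable def homogeneousSubspace (K : Type*) [Field K] (w : σ → ℕ) (e : ℕ) :
    Submodule K (MvPowerSeries σ K) :=
  LinearMap.range (weightedHomogeneousComponent (R := K) w e)

variable {w : σ → ℕ}

theorem mem_homogeneousSubspace {e : ℕ} {h : MvPowerSeries σ K} :
    h ∈ homogeneousSubspace K w e ↔ h.IsWeightedHomogeneous w e := by
  constructor
  · rintro ⟨h, rfl⟩
    exact isWeightedHomogeneous_weightedHomogeneousComponent w h e
  · intro hh
    exact ⟨h, (isWeightedHomogeneous_iff_eq_weightedHomogeneousComponent.1 hh).symm⟩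

theorem finiteDimensional_homogeneousSubspace [Finite σ] (hw : ∀ i, 0 < w i) (e : ℕ) :
    FiniteDimensional K (homogeneousSubspace K w e) := by
  have : Finite {α : σ →₀ ℕ | weight w α ≤ e} :=
    finite_of_nat_weight_le w (fun i => (hw i).ne') e
  let f : homogeneousSubspace K w e →ₗ[K] ({α : σ →₀ ℕ | weight w α ≤ e} → K) :=
    (LinearMap.pi fun α => coeff (α : σ →₀ ℕ)) ∘ₗ (homogeneousSubspace K w e).subtype
  refine Module.Finite.of_injective f ?_
  rw [← LinearMap.ker_eq_bot, LinearMap.ker_eq_bot']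
  rintro ⟨h, hh⟩ h0
  rw [mem_homogeneousSubspace] at hh
  ext α
  by_cases hα : weight w α ≤ e
  · exact congrFun h0 ⟨α, hα⟩
  · exact hh.coeff_eq_zero (by omega)

/-- The homogeneous part of degree `e` of an ideal. -/
noncomputable def homogeneousPart (w : σ → ℕ) (I : Ideal (MvPowerSeries σ K)) (e : ℕ) :
    Submodule K (MvPowerSeries σ K) :=
  homogeneousSubspace K w e ⊓ I.restrictScalars K

theorem mem_homogeneousPart {I : Ideal (MvPowerSeries σ K)} {e : ℕ} {h : MvPowerSeries σ K} :
    h ∈ homogeneousPart w I e ↔ h.IsWeightedHomogeneous w e ∧ h ∈ I := by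
  rw [homogeneousPart, Submodule.mem_inf, mem_homogeneousSubspace]
  rfl

/-- The Hilbert function of the quotient by an ideal. -/
noncomputable def hilbertFunction (w : σ → ℕ) (I : Ideal (MvPowerSeries σ K)) (e : ℕ) : ℤ :=
  Module.finrank K (homogeneousSubspace K w e) - Module.finrank K (homogeneousPart w I e)

variable {G : ℕ → MvPowerSeries σ K} {d : ℕ → ℕ} {m : ℕ}

theorem span_image_range_succ (G : ℕ → MvPowerSeries σ K) (k : ℕ) :
    Ideal.span (G '' Finset.range (k + 1)) =
      Ideal.span (G '' Finset.range k) ⊔ Ideal.span {G k} := by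
  rw [Finset.range_add_one, Finset.coe_insert, Set.image_insert_eq, Ideal.span_insert, sup_comm]

theorem homogeneousPart_succ_of_lt (hG : ∀ i < m + 1, (G i).IsWeightedHomogeneous w (d i)) {e : ℕ}
    (he : e < d m) : homogeneousPart w (Ideal.span (G '' Finset.range (m + 1))) e =
      homogeneousPart w (Ideal.span (G '' Finset.range m)) e := by
  ext h
  rw [mem_homogeneousPart, mem_homogeneousPart]
  refine and_congr_right fun hh => ⟨fun hmem => ?_, fun hmem => ?_⟩
  · obtain ⟨a, ha, rfl⟩ := exists_homogeneous_combination
      (fun i hi => hG i (Finset.mem_range.1 hi)) hh hmem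
    have ham : a m = 0 := by
      ext α
      by_contra hne
      have := ha m α hne
      omega
    rw [Finset.sum_range_succ, ham, zero_mul, add_zero]
    exact mem_span_image_finset.2 ⟨a, rfl⟩
  · rw [span_image_range_succ]
    exact Ideal.mem_sup_left hmem

theorem homogeneousPart_succ_add (hG : ∀ i < m + 1, (G i).IsWeightedHomogeneous w (d i)) (e : ℕ) :
    homogeneousPart w (Ideal.span (G '' Finset.range (m + 1))) (e + d m) =
      homogeneousPart w (Ideal.span (G '' Finset.range m)) (e + d m) ⊔
        (homogeneousSubspace K w e).map (LinearMap.mulRight K (G m)) := by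
  have hGm : (G m).IsWeightedHomogeneous w (d m) := hG m (Nat.lt_succ_self m)
  apply le_antisymm
  · intro h hh
    rw [mem_homogeneousPart] at hh
    obtain ⟨a, ha, rfl⟩ := exists_homogeneous_combination
      (fun i hi => hG i (Finset.mem_range.1 hi)) hh.1 hh.2
    have ham : (a m).IsWeightedHomogeneous w e := by
      have h1 : (a m).IsWeightedHomogeneous w (e + d m - d m) := (ha m).isWeightedHomogeneous
      rwa [Nat.add_sub_cancel] at h1
    have h1 : a m * G m ∈ homogeneousSubspace K w (e + d m) :=
      mem_homogeneousSubspace.2 (ham.mul hGm)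
    rw [Finset.sum_range_succ] at hh ⊢
    refine Submodule.add_mem_sup (mem_homogeneousPart.2
      ⟨?_, mem_span_image_finset.2 ⟨a, rfl⟩⟩) ⟨a m, mem_homogeneousSubspace.2 ham, rfl⟩
    rw [← mem_homogeneousSubspace]
    simpa using sub_mem (mem_homogeneousSubspace.2 hh.1) h1
  · refine sup_le (fun h hh => ?_) ?_
    · rw [mem_homogeneousPart] at hh ⊢
      refine ⟨hh.1, ?_⟩
      rw [span_image_range_succ]
      exact Ideal.mem_sup_left hh.2
    · rintro _ ⟨a, ha, rfl⟩
      exact mem_homogeneousPart.2 ⟨IsWeightedHomogeneous.mul (mem_homogeneousSubspace.1 ha) hGm,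
        Ideal.mul_mem_left _ _ (Ideal.subset_span ⟨m, by simp, rfl⟩)⟩

/-- This is where regularity enters the dimension count: `a * G m` lies in the earlier ideal only if
`a` does. -/
theorem IsRegularFamily.homogeneousPart_inf (hreg : IsRegularFamily G (m + 1))
    (hGm : (G m).IsWeightedHomogeneous w (d m)) (e : ℕ) :
    homogeneousPart w (Ideal.span (G '' Finset.range m)) (e + d m) ⊓
        (homogeneousSubspace K w e).map (LinearMap.mulRight K (G m)) =
      (homogeneousPart w (Ideal.span (G '' Finset.range m)) e).map
        (LinearMap.mulRight K (G m)) := by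
  apply le_antisymm
  · rintro _ ⟨h1, a, ha, rfl⟩
    exact ⟨a, mem_homogeneousPart.2 ⟨mem_homogeneousSubspace.1 ha,
      hreg m (Nat.lt_succ_self m) a (mem_homogeneousPart.1 h1).2⟩, rfl⟩
  · rintro _ ⟨a, ha, rfl⟩
    obtain ⟨ha, haI⟩ := mem_homogeneousPart.1 ha
    exact ⟨mem_homogeneousPart.2 ⟨ha.mul hGm, Ideal.mul_mem_right _ _ haI⟩, a,
      mem_homogeneousSubspace.2 ha, rfl⟩

variable [Finite σ]

/-- The dimension count for the exact sequence given by multiplication by `G m` on the quotient by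
the earlier generators. -/
theorem IsRegularFamily.hilbertFunction_succ (hw : ∀ i, 0 < w i) (hreg : IsRegularFamily G (m + 1))
    (hG : ∀ i < m + 1, (G i).IsWeightedHomogeneous w (d i)) (hne : G m ≠ 0) (e : ℕ) :
    hilbertFunction w (Ideal.span (G '' Finset.range (m + 1))) (e + d m) =
      hilbertFunction w (Ideal.span (G '' Finset.range m)) (e + d m) -
        hilbertFunction w (Ideal.span (G '' Finset.range m)) e := by
  have := finiteDimensional_homogeneousSubspace (K := K) hw
  have hfin : ∀ (I : Ideal (MvPowerSeries σ K)) e,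
      FiniteDimensional K (homogeneousPart w I e) := fun I e =>
    Submodule.finiteDimensional_of_le (inf_le_left : _ ≤ homogeneousSubspace K w e)
  have hinj : Function.Injective (LinearMap.mulRight K (G m)) := fun a b hab =>
    mul_right_cancel₀ hne hab
  have hmap : ∀ p : Submodule K (MvPowerSeries σ K),
      Module.finrank K (p.map (LinearMap.mulRight K (G m))) = Module.finrank K p := fun p =>
    (Submodule.equivMapOfInjective _ hinj p).finrank_eq.symm
  have key := Submodule.finrank_sup_add_finrank_inf_eq
    (homogeneousPart w (Ideal.span (G '' Finset.range m)) (e + d m))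
    ((homogeneousSubspace K w e).map (LinearMap.mulRight K (G m)))
  rw [← homogeneousPart_succ_add hG, hreg.homogeneousPart_inf (hG m (Nat.lt_succ_self m)), hmap,
    hmap] at key
  simp only [hilbertFunction]
  omega

/-- The Hilbert series of the quotient by a homogeneous regular sequence. -/
theorem IsRegularFamily.hilbertSeries_eq (hw : ∀ i, 0 < w i) (hreg : IsRegularFamily G m)
    (hG : ∀ i < m, (G i).IsWeightedHomogeneous w (d i)) (hne : ∀ i < m, G i ≠ 0) :
    PowerSeries.mk (hilbertFunction w (Ideal.span (G '' Finset.range m))) =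
      (∏ i ∈ Finset.range m, (1 - PowerSeries.X ^ d i)) *
        PowerSeries.mk (hilbertFunction w (⊥ : Ideal (MvPowerSeries σ K))) := by
  induction m with
  | zero => simp
  | succ m ih =>
    rw [Finset.prod_range_succ, mul_comm (∏ i ∈ _, _), mul_assoc,
      ← ih (hreg.mono (Nat.le_succ m)) (fun i hi => hG i (Nat.lt_succ_of_lt hi))
        (fun i hi => hne i (Nat.lt_succ_of_lt hi))]
    ext e
    rw [sub_mul, one_mul, map_sub, PowerSeries.coeff_X_pow_mul', PowerSeries.coeff_mk,
      PowerSeries.coeff_mk]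
    split_ifs with hde
    · rw [PowerSeries.coeff_mk]
      have := hreg.hilbertFunction_succ hw hG (hne m (Nat.lt_succ_self m)) (e - d m)
      rwa [Nat.sub_add_cancel hde] at this
    · rw [sub_zero, hilbertFunction, homogeneousPart_succ_of_lt hG (not_le.1 hde), hilbertFunction]

omit [Finite σ] in
theorem linearIndependent_of_mk {I : Ideal (MvPowerSeries σ K)} {κ : Type*} {b : κ → σ →₀ ℕ}
    (hli : LinearIndependent K fun k => Ideal.Quotient.mk I (monomial (b k) (1 : K))) :
    LinearIndependent K fun k => monomial (b k) (1 : K) :=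
  LinearIndependent.of_comp (Ideal.Quotient.mkₐ K I).toLinearMap hli

/-- A monomial basis of the quotient by a homogeneous ideal computes its Hilbert function. -/
theorem hilbertFunction_eq_card (hw : ∀ i, 0 < w i) {ι : Type*} {s : Finset ι}
    {F : ι → MvPowerSeries σ K} {c : ι → ℕ} (hF : ∀ i ∈ s, (F i).IsWeightedHomogeneous w (c i))
    {κ : Type*} [Fintype κ] {b : κ → σ →₀ ℕ}
    (hli : LinearIndependent K fun k =>
      Ideal.Quotient.mk (Ideal.span (F '' s)) (monomial (b k) (1 : K)))
    (hb : ∀ h : MvPowerSeries σ K,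
      ∃ v ∈ Submodule.span K (Set.range fun k => monomial (b k) (1 : K)),
        h - v ∈ Ideal.span (F '' s)) (e : ℕ) :
    hilbertFunction w (Ideal.span (F '' s)) e =
      (Finset.univ.filter fun k => weight w (b k) = e).card := by
  classical
  have := finiteDimensional_homogeneousSubspace (K := K) hw e
  set I := Ideal.span (F '' s) with hI
  have hfin : FiniteDimensional K (homogeneousPart w I e) :=
    Submodule.finiteDimensional_of_le (inf_le_left : _ ≤ homogeneousSubspace K w e)
  -- The span of the basis monomials of weight `e`, shown to be a complement of the degree `e` part
  -- of `I`.
  let U : Submodule K (MvPowerSeries σ K) :=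
    Submodule.span K (Set.range fun k : {k // weight w (b k) = e} => monomial (b k) (1 : K))
  have hUfin : FiniteDimensional K U := FiniteDimensional.span_of_finite K (Set.finite_range _)
  have hUrank : Module.finrank K U = (Finset.univ.filter fun k => weight w (b k) = e).card := by
    have hU : LinearIndependent K fun k : {k // weight w (b k) = e} => monomial (b k) (1 : K) :=
      (linearIndependent_of_mk hli).comp _ Subtype.val_injective
    rw [finrank_span_eq_card hU, Fintype.card_subtype]
  have hUS : U ≤ homogeneousSubspace K w e := by
    rw [Submodule.span_le]
    rintro _ ⟨⟨k, hk⟩, rfl⟩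
    exact ⟨monomial (b k) 1, by rw [weightedHomogeneousComponent_monomial, if_pos hk]⟩
  have hcompU : ∀ v ∈ Submodule.span K (Set.range fun k => monomial (b k) (1 : K)),
      weightedHomogeneousComponent w e v ∈ U := by
    intro v hv
    induction hv using Submodule.span_induction with
    | mem x hx =>
      obtain ⟨k, rfl⟩ := hx
      simp only [weightedHomogeneousComponent_monomial]
      split_ifs with hk
      · exact Submodule.subset_span ⟨⟨k, hk⟩, rfl⟩
      · exact zero_mem _
    | zero => simp
    | add x y _ _ hx hy => rw [map_add]; exact add_mem hx hy
    | smul a x _ hx => rw [map_smul]; exact Submodule.smul_mem _ _ hx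
  have hsup : U ⊔ homogeneousPart w I e = homogeneousSubspace K w e := by
    apply le_antisymm (sup_le hUS inf_le_left)
    intro h hh
    rw [mem_homogeneousSubspace] at hh
    obtain ⟨v, hv, hvh⟩ := hb h
    have h1 := weightedHomogeneousComponent_mem_span hF e hvh
    rw [map_sub, ← isWeightedHomogeneous_iff_eq_weightedHomogeneousComponent.1 hh] at h1
    rw [← add_sub_cancel (weightedHomogeneousComponent w e v) h]
    refine Submodule.add_mem_sup (hcompU v hv) (mem_homogeneousPart.2 ⟨?_, h1⟩)
    rw [← mem_homogeneousSubspace]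
    exact sub_mem (mem_homogeneousSubspace.2 hh) ⟨v, rfl⟩
  have hinf : U ⊓ homogeneousPart w I e = ⊥ := by
    rw [eq_bot_iff]
    rintro h ⟨hU, hh⟩
    have hhI := (mem_homogeneousPart.1 hh).2
    obtain ⟨a, rfl⟩ := (Submodule.mem_span_range_iff_exists_fun K).1 hU
    have h0 := (sum_smul_monomial_mem_iff I Finset.univ a
      (fun k : {k // weight w (b k) = e} => b k)).2 hhI
    have h1 := Fintype.linearIndependent_iff.1 (hli.comp _ (Subtype.val_injective
      (p := fun k => weight w (b k) = e))) a h0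
    simp [h1]
  have key := Submodule.finrank_sup_add_finrank_inf_eq U (homogeneousPart w I e)
  rw [hsup, hinf, finrank_bot, hUrank] at key
  rw [hilbertFunction]
  omega

/-- The Hilbert polynomial identity attached to a monomial basis of the quotient by a homogeneous
regular sequence. -/
theorem IsRegularFamily.sum_X_pow_eq (hw : ∀ i, 0 < w i) (hreg : IsRegularFamily G m)
    (hG : ∀ i < m, (G i).IsWeightedHomogeneous w (d i)) (hne : ∀ i < m, G i ≠ 0)
    {κ : Type*} [Fintype κ] {b : κ → σ →₀ ℕ}
    (hli : LinearIndependent K fun k =>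
      Ideal.Quotient.mk (Ideal.span (G '' Finset.range m)) (monomial (b k) (1 : K)))
    (hb : ∀ h : MvPowerSeries σ K,
      ∃ v ∈ Submodule.span K (Set.range fun k => monomial (b k) (1 : K)),
        h - v ∈ Ideal.span (G '' Finset.range m)) :
    ((∑ k, Polynomial.X ^ weight w (b k) : Polynomial ℤ) : PowerSeries ℤ) =
      ((∏ i ∈ Finset.range m, (1 - Polynomial.X ^ d i) : Polynomial ℤ) : PowerSeries ℤ) *
        PowerSeries.mk (hilbertFunction w (⊥ : Ideal (MvPowerSeries σ K))) := by
  have hprod : ((∏ i ∈ Finset.range m, (1 - Polynomial.X ^ d i) : Polynomial ℤ) : PowerSeries ℤ) =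
      ∏ i ∈ Finset.range m, (1 - PowerSeries.X ^ d i) := by
    rw [← Polynomial.coeToPowerSeries.ringHom_apply, map_prod]
    simp
  rw [hprod, ← hreg.hilbertSeries_eq hw hG hne]
  ext e
  rw [PowerSeries.coeff_mk, hilbertFunction_eq_card hw
    (fun i hi => hG i (Finset.mem_range.1 hi)) hli hb e, Polynomial.coeff_coe,
    Polynomial.finsetSum_coeff]
  simp [Polynomial.coeff_X_pow, eq_comm]

end HilbertSeries

/-! ### Finite colength, regularity and the product formula. -/

section FiniteColength

variable {K : Type*} [Field K] {n : ℕ}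

/-- Extension of a finite family to a sequence. -/
def extendFamily (F : Fin n → MvPowerSeries (Fin n) K) (j : ℕ) : MvPowerSeries (Fin n) K :=
  if h : j < n then F ⟨j, h⟩ else 0

theorem extendFamily_of_lt (F : Fin n → MvPowerSeries (Fin n) K) {j : ℕ} (h : j < n) :
    extendFamily F j = F ⟨j, h⟩ := dif_pos h

theorem extendFamily_image (F : Fin n → MvPowerSeries (Fin n) K) {k : ℕ} (hk : k ≤ n) :
    extendFamily F '' Finset.range k = F '' {j | j.1 < k} := by
  ext r
  constructor
  · rintro ⟨j, hj, rfl⟩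
    have hj' : j < k := by simpa using hj
    exact ⟨⟨j, hj'.trans_le hk⟩, hj', (extendFamily_of_lt F _).symm⟩
  · rintro ⟨j, hj, rfl⟩
    exact ⟨j, by simpa using hj, extendFamily_of_lt F j.2⟩

theorem extendFamily_image_range (F : Fin n → MvPowerSeries (Fin n) K) :
    extendFamily F '' Finset.range n = Set.range F := by
  rw [extendFamily_image F le_rfl, ← Set.image_univ]
  congr 1
  ext j
  simp

theorem isRegularFamily_X_pow (N : ℕ) :
    IsRegularFamily (extendFamily fun i : Fin n => (X i : MvPowerSeries (Fin n) K) ^ N) n := by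
  intro k hk c hc
  rw [extendFamily_image _ hk.le] at hc ⊢
  rw [extendFamily_of_lt _ hk, mul_comm] at hc
  exact mem_span_X_pow_of_X_pow_mul_mem (Set.toFinite _) (by simp) hc

/-- `n` power series without constant term generating an ideal of finite colength in the ring of
power series in `n` variables form a regular sequence. -/
theorem isRegularFamily_of_finite [Infinite K] (F : Fin n → MvPowerSeries (Fin n) K)
    (hF : ∀ i, F i ∈ IsLocalRing.maximalIdeal (MvPowerSeries (Fin n) K))
    [Module.Finite K (MvPowerSeries (Fin n) K ⧸ Ideal.span (Set.range F))] :
    IsRegularFamily (extendFamily F) n := by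
  obtain ⟨N, hN⟩ := exists_X_pow_mem (Ideal.span (Set.range F))
  have hX := isRegularFamily_iff_isWeaklyRegular.1 (isRegularFamily_X_pow (K := K) (n := n) N)
  rw [isRegularFamily_iff_isWeaklyRegular]
  refine RegularSequenceExchange.isWeaklyRegular_of_ofList K n _ _ _ (by simp) (by simp) ?_ ?_ hX
  · intro a ha
    obtain ⟨j, hj, rfl⟩ := List.mem_map.1 ha
    rw [extendFamily_of_lt F (List.mem_range.1 hj)]
    exact hF _
  · intro r hr
    obtain ⟨j, hj, rfl⟩ := List.mem_map.1 hr
    rw [extendFamily_of_lt _ (List.mem_range.1 hj)]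
    have : Ideal.ofList ((List.range n).map (extendFamily F)) = Ideal.span (Set.range F) := by
      rw [← extendFamily_image_range, Ideal.ofList]
      congr 1
      ext r
      simp
    rw [this]
    exact hN _

theorem ne_zero_of_isRegularFamily {m : ℕ} {G : ℕ → MvPowerSeries (Fin n) K}
    (hG : ∀ i < m, G i ∈ IsLocalRing.maximalIdeal (MvPowerSeries (Fin n) K))
    (hreg : IsRegularFamily G m) (i : ℕ) (hi : i < m) : G i ≠ 0 := by
  intro h0
  have h1 := hreg i hi 1 (by rw [h0, mul_zero]; exact zero_mem _)
  have hle : Ideal.span (G '' Finset.range i) ≤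
      IsLocalRing.maximalIdeal (MvPowerSeries (Fin n) K) := by
    rw [Ideal.span_le]
    rintro _ ⟨j, hj, rfl⟩
    exact hG j ((Finset.mem_range.1 hj).trans hi)
  exact (IsLocalRing.maximalIdeal.isMaximal _).ne_top ((Ideal.eq_top_iff_one _).2 (hle h1))

theorem isWeightedHomogeneous_X (w : Fin n → ℕ) (i : Fin n) :
    (X i : MvPowerSeries (Fin n) K).IsWeightedHomogeneous w (w i) := by
  intro α hα
  classical
  rw [coeff_X] at hα
  split_ifs at hα with h
  · rw [h, weight_single, one_smul]
  · exact absurd rfl hα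

/-- The Hilbert series of the power series ring comes from the regular sequence of the variables
themselves: the quotient is `K`, with the single basis monomial `1`. -/
theorem prod_X_mul_mk_hilbertFunction_bot {w : Fin n → ℕ} (hw : ∀ i, 0 < w i) :
    ((∏ i, (1 - Polynomial.X ^ w i) : Polynomial ℤ) : PowerSeries ℤ) *
      PowerSeries.mk (hilbertFunction w (⊥ : Ideal (MvPowerSeries (Fin n) K))) = 1 := by
  have hreg := isRegularFamily_X_pow (K := K) (n := n) 1
  simp only [pow_one] at hreg
  have hspan : Ideal.span (extendFamily (fun i => (X i : MvPowerSeries (Fin n) K)) ''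
      Finset.range n) = IsLocalRing.maximalIdeal _ := by
    rw [extendFamily_image_range, maximalIdeal_eq_span]
  have key := hreg.sum_X_pow_eq (w := w) (d := fun j => if h : j < n then w ⟨j, h⟩ else 0)
    (κ := Unit) (b := fun _ => 0) hw
    (fun i hi => by
      rw [extendFamily_of_lt _ hi, dif_pos hi]
      exact isWeightedHomogeneous_X w _)
    (fun i hi => by
      rw [extendFamily_of_lt _ hi]
      intro h0
      have := coeff_index_single_self_X (R := K) (⟨i, hi⟩ : Fin n)
      rw [h0] at this
      simp at this)
    (by
      rw [hspan, linearIndependent_unique_iff, Ne, Ideal.Quotient.eq_zero_iff_mem]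
      intro h
      exact (IsLocalRing.maximalIdeal.isMaximal _).ne_top ((Ideal.eq_top_iff_one _).2 h))
    (by
      intro h
      refine ⟨C (constantCoeff h), ?_, ?_⟩
      · rw [← mul_one (constantCoeff h), ← smul_eq_mul, ← monomial_zero_eq_C_apply, map_smul]
        exact Submodule.smul_mem _ _ (Submodule.subset_span ⟨(), rfl⟩)
      · rw [extendFamily_image_range]
        exact sub_C_constantCoeff_mem h)
  rw [Finset.prod_range] at key
  simp only [Fin.is_lt, dite_true, Fin.eta] at key
  rw [← key]
  simp

/-- The colength of an ideal generated by a regular sequence of weighted homogeneous elements. -/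
theorem IsRegularFamily.card_mul_prod {w : Fin n → ℕ} (hw : ∀ i, 0 < w i)
    {F : Fin n → MvPowerSeries (Fin n) K} {d : Fin n → ℕ} (hreg : IsRegularFamily (extendFamily F) n)
    (hF : ∀ i, (F i).IsWeightedHomogeneous w (d i)) (hne : ∀ i, F i ≠ 0)
    {m : ℕ} {b : Fin m → Fin n →₀ ℕ}
    (hli : LinearIndependent K fun k =>
      Ideal.Quotient.mk (Ideal.span (Set.range F)) (monomial (b k) (1 : K)))
    (hb : ∀ h : MvPowerSeries (Fin n) K,
      ∃ v ∈ Submodule.span K (Set.range fun k => monomial (b k) (1 : K)),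
        h - v ∈ Ideal.span (Set.range F)) :
    m * ∏ i, w i = ∏ i, d i := by
  rw [← extendFamily_image_range] at hli hb
  have key := hreg.sum_X_pow_eq (w := w) (d := fun j => if h : j < n then d ⟨j, h⟩ else 0) hw
    (fun i hi => by
      rw [extendFamily_of_lt _ hi, dif_pos hi]
      exact hF _)
    (fun i hi => by
      rw [extendFamily_of_lt _ hi]
      exact hne _) hli hb
  rw [Finset.prod_range] at key
  simp only [Fin.is_lt, dite_true, Fin.eta] at key
  have h1 := congrArg (· * ((∏ i, (1 - Polynomial.X ^ w i) : Polynomial ℤ) : PowerSeries ℤ)) key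
  rw [mul_assoc, mul_comm (PowerSeries.mk _), prod_X_mul_mk_hilbertFunction_bot hw, mul_one,
    ← Polynomial.coe_mul, Polynomial.coe_inj] at h1
  -- Both products contain `(1 - t) ^ n`. After cancelling it, evaluation at `t = 1` turns each
  -- geometric sum into its number of terms.
  have hgeom : ∀ e : Fin n → ℕ, (∏ i, (1 - Polynomial.X ^ e i) : Polynomial ℤ) =
      (1 - Polynomial.X) ^ n * ∏ i, ∑ k ∈ Finset.range (e i), Polynomial.X ^ k := by
    intro e
    rw [Finset.prod_congr rfl fun i _ => (mul_neg_geom_sum (Polynomial.X : Polynomial ℤ) (e i)).symm,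
      Finset.prod_mul_distrib, Finset.prod_const, Finset.card_univ, Fintype.card_fin]
  rw [hgeom, hgeom, mul_left_comm] at h1
  have hX : (1 - Polynomial.X : Polynomial ℤ) ≠ 0 := by
    intro h0
    have := congrArg (Polynomial.eval 0) h0
    simp at this
  have h2 := congrArg (Polynomial.eval 1) (mul_left_cancel₀ (pow_ne_zero _ hX) h1)
  simp only [Polynomial.eval_mul, Polynomial.eval_finsetSum, Polynomial.eval_prod,
    Polynomial.eval_pow, Polynomial.eval_X, one_pow, Finset.sum_const, Finset.card_univ,
    Fintype.card_fin, Finset.card_range, nsmul_eq_mul, mul_one] at h2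
  exact_mod_cast h2

end FiniteColength

end MvPowerSeries

namespace MvPowerSeries

/-! ### Derivations of the power series ring. -/

section Derivation

variable {K : Type*} [Field K] {n : ℕ}

/-- No continuity is assumed. Writing `h = h(0) + ∑ x_i a_i` gives `E h = ∑ x_i E(a_i)`, and
iterating puts `E h` in every order ideal. -/
theorem derivation_eq_zero
    (E : Derivation K (MvPowerSeries (Fin n) K) (MvPowerSeries (Fin n) K))
    (hE : ∀ i, E (X i) = 0) : E = 0 := by
  let w : Fin n → ℕ := fun _ => 1
  have key : ∀ (N : ℕ) (h : MvPowerSeries (Fin n) K), E h ∈ orderIdeal w N := by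
    intro N
    induction N with
    | zero => exact fun h => mem_orderIdeal_zero _
    | succ N ih =>
      intro h
      obtain ⟨a, ha⟩ := (Ideal.mem_span_range_iff_exists_fun).1 (sub_C_constantCoeff_mem h)
      have hC : E (C (constantCoeff h)) = 0 := E.map_algebraMap (constantCoeff h)
      have hEh : E h = ∑ i, X i * E (a i) := by
        rw [← sub_zero (E h), ← hC, ← map_sub, ← ha, map_sum]
        refine Finset.sum_congr rfl fun i _ => ?_
        rw [Derivation.leibniz, hE, smul_zero, zero_add, smul_eq_mul]
      rw [hEh, add_comm]
      exact sum_mem fun i _ => mul_mem_orderIdeal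
        (mem_orderIdeal_of_isWeightedHomogeneous (isWeightedHomogeneous_X w i) le_rfl) (ih _)
  ext h α
  exact mem_orderIdeal.1 (key _ h) α (Nat.lt_succ_self _)

/-- Every derivation of the ring of power series is a combination of the partial derivatives. -/
theorem derivation_apply_eq
    (D : Derivation K (MvPowerSeries (Fin n) K) (MvPowerSeries (Fin n) K))
    (h : MvPowerSeries (Fin n) K) : D h = ∑ i, D (X i) * pderiv K i h := by
  have h0 : D - ∑ i, D (X i) • pderiv K i = 0 := by
    apply derivation_eq_zero
    intro j
    have hsum : (∑ i, D (X i) • pderiv K i : Derivation K (MvPowerSeries (Fin n) K) _) (X j) =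
        ∑ i, D (X i) * pderiv K i (X j) := by
      rw [← Derivation.coeFnAddMonoidHom_apply, map_sum, Finset.sum_apply]
      rfl
    rw [Derivation.sub_apply, hsum, Finset.sum_eq_single j]
    · simp
    · intro i _ hij
      rw [pderiv_X_of_ne hij.symm, mul_zero]
    · simp
  have h1 := DFunLike.congr_fun (sub_eq_zero.1 h0) h
  rw [h1, ← Derivation.coeFnAddMonoidHom_apply, map_sum, Finset.sum_apply]
  rfl

/-- The chain rule for an automorphism, up to the coefficients. -/
theorem map_pderiv_mem_span (φ : MvPowerSeries (Fin n) K ≃ₐ[K] MvPowerSeries (Fin n) K)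
    (f : MvPowerSeries (Fin n) K) (i : Fin n) :
    φ (pderiv K i f) ∈ Ideal.span (Set.range fun j => pderiv K j (φ f)) := by
  -- Conjugating `∂ᵢ` by `φ` gives a derivation, so `φ` never has to be described as a substitution.
  let D : Derivation K (MvPowerSeries (Fin n) K) (MvPowerSeries (Fin n) K) :=
    Derivation.mk' (φ.toLinearMap ∘ₗ (pderiv K i).toLinearMap ∘ₗ φ.symm.toLinearMap) (by
      intro a b
      simp [Derivation.leibniz])
  have hD : D (φ f) = φ (pderiv K i f) := by
    change φ (pderiv K i (φ.symm (φ f))) = _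
    rw [φ.symm_apply_apply]
  rw [← hD, derivation_apply_eq]
  exact sum_mem fun j _ => Ideal.mul_mem_left _ _ (Ideal.subset_span ⟨j, rfl⟩)

end Derivation

end MvPowerSeries

namespace PowerSeriesSingularity

open MvPowerSeries

variable {K : Type*} [Field K] {n : ℕ}

theorem toENat_rank_lt_top_iff {V : Type*} [AddCommGroup V] [Module K V] :
    Cardinal.toENat (Module.rank K V) < ⊤ ↔ Module.Finite K V := by
  rw [← Module.rank_lt_aleph0_iff, Cardinal.toENat_lt_top]

/-! ### Partial derivatives of the initial form. -/

section InitialForm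

variable {w : Fin n → ℕ} {f : MvPowerSeries (Fin n) K}

theorem isWeightedHomogeneous_initialForm (w : Fin n → ℕ) (f : MvPowerSeries (Fin n) K) :
    (initialForm w f).IsWeightedHomogeneous w (f.weightedOrder w).toNat :=
  isWeightedHomogeneous_weightedHomogeneousComponent w f _

theorem sub_initialForm_mem (w : Fin n → ℕ) (f : MvPowerSeries (Fin n) K) :
    f - initialForm w f ∈ orderIdeal w ((f.weightedOrder w).toNat + 1) :=
  sub_weightedHomogeneousComponent_mem (ENat.natCast_toNat_le_self _)

theorem weight_add_of_coeff_pderiv_ne_zero {F : MvPowerSeries (Fin n) K} {d : ℕ}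
    (hF : F.IsWeightedHomogeneous w d) (i : Fin n) {α : Fin n →₀ ℕ}
    (hα : coeff α (pderiv K i F) ≠ 0) : Finsupp.weight w α + w i = d := by
  rw [coeff_pderiv] at hα
  have := hF (left_ne_zero_of_mul hα)
  rwa [map_add, Finsupp.weight_single, one_smul] at this

theorem isWeightedHomogeneous_pderiv {F : MvPowerSeries (Fin n) K} {d : ℕ}
    (hF : F.IsWeightedHomogeneous w d) (i : Fin n) :
    (pderiv K i F).IsWeightedHomogeneous w (d - w i) := by
  intro α hα
  have := weight_add_of_coeff_pderiv_ne_zero hF i hα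
  omega

theorem le_of_pderiv_ne_zero {F : MvPowerSeries (Fin n) K} {d : ℕ}
    (hF : F.IsWeightedHomogeneous w d) {i : Fin n} (hne : pderiv K i F ≠ 0) : w i ≤ d := by
  obtain ⟨α, hα⟩ := (ne_zero_iff_exists_coeff_ne_zero _).1 hne
  have := weight_add_of_coeff_pderiv_ne_zero hF i hα
  omega

/-- The condition `w i ≤ d` matters: for `f = x + y` with weights `2, 1` one has `F = y`, and `∂f/∂x
- ∂F/∂x = 1` has order `0`, not `1`. -/
theorem pderiv_sub_mem_orderIdeal {F f : MvPowerSeries (Fin n) K} {d : ℕ} {i : Fin n}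
    (hf : f - F ∈ orderIdeal w (d + 1)) (hi : w i ≤ d) :
    pderiv K i f - pderiv K i F ∈ orderIdeal w (d - w i + 1) := by
  rw [← map_sub]
  rw [mem_orderIdeal] at hf ⊢
  intro α hα
  rw [coeff_pderiv, hf, zero_mul]
  rw [map_add, Finsupp.weight_single, one_smul]
  omega

end InitialForm

/-! ### The inequality of Tjurina numbers. -/

section Tjurina

theorem tjurinaNumber_le_initialForm {w : Fin n → ℕ} (hw : ∀ i, 0 < w i)
    (f : MvPowerSeries (Fin n) K) : tjurinaNumber f ≤ tjurinaNumber (initialForm w f) := by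
  classical
  rcases (le_top : tjurinaNumber (initialForm w f) ≤ ⊤).eq_or_lt with h | h
  · exact h ▸ le_top
  set F := initialForm w f
  set e := (f.weightedOrder w).toNat
  have hF : F.IsWeightedHomogeneous w e := isWeightedHomogeneous_initialForm w f
  have hfF : f - F ∈ orderIdeal w (e + 1) := sub_initialForm_mem w f
  have : Module.Finite K (MvPowerSeries (Fin n) K ⧸ tjurinaIdeal F) := toENat_rank_lt_top_iff.1 h
  -- `none` stands for `F` itself. Zero partials of `F` are dropped: they add nothing to the ideal,
  -- and for them `w i` may exceed `e`.
  let s : Finset (Option (Fin n)) :=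
    Finset.univ.filter fun o => ∀ i, o = some i → pderiv K i F ≠ 0
  let G : Option (Fin n) → MvPowerSeries (Fin n) K := fun o => o.elim F fun i => pderiv K i F
  let g : Option (Fin n) → MvPowerSeries (Fin n) K := fun o => o.elim f fun i => pderiv K i f
  let d : Option (Fin n) → ℕ := fun o => o.elim e fun i => e - w i
  have hspan : Ideal.span (G '' s) = tjurinaIdeal F := by
    apply le_antisymm
    · rw [Ideal.span_le]
      rintro _ ⟨o, -, rfl⟩
      rcases o with _ | i
      · exact Ideal.mem_sup_left (Ideal.mem_span_singleton_self _)
      · exact Ideal.mem_sup_right (Ideal.subset_span ⟨i, rfl⟩)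
    · refine sup_le ?_ ?_
      · rw [Ideal.span_singleton_le_iff_mem]
        exact Ideal.subset_span ⟨none, by simp [s], rfl⟩
      · rw [jacobianIdeal, Ideal.span_le]
        rintro _ ⟨i, rfl⟩
        by_cases hi : pderiv K i F = 0
        · simp [hi]
        · exact Ideal.subset_span ⟨some i, by simp [s, hi], rfl⟩
  have hG : ∀ o ∈ s, (G o).IsWeightedHomogeneous w (d o) := by
    rintro (_ | i) -
    exacts [hF, isWeightedHomogeneous_pderiv hF i]
  have hg : ∀ o ∈ s, g o - G o ∈ orderIdeal w (d o + 1) := by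
    rintro (_ | i) hi
    · exact hfF
    · exact pderiv_sub_mem_orderIdeal hfF
        (le_of_pderiv_ne_zero hF ((Finset.mem_filter.1 hi).2 i rfl))
  have hJ : ∀ o ∈ s, g o ∈ tjurinaIdeal f := by
    rintro (_ | i) -
    · exact Ideal.mem_sup_left (Ideal.mem_span_singleton_self _)
    · exact Ideal.mem_sup_right (Ideal.subset_span ⟨i, rfl⟩)
  obtain ⟨m, b, hli, hb⟩ := exists_monomial_basis (tjurinaIdeal F)
  rw [tjurinaNumber, tjurinaNumber, rank_eq_of_monomial_basis hli hb]
  rw [← hspan] at hb this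
  exact Cardinal.toENat.monotone'
    (rank_le_of_monomial_span (exists_span_sub_mem_of_initialForms hw hG hg hJ b hb))

end Tjurina

/-! ### The equality and the formula for Milnor numbers. -/

section Milnor

theorem milnorNumber_eq_zero_of_isUnit {f : MvPowerSeries (Fin n) K} {i : Fin n}
    (h : IsUnit (pderiv K i f)) : milnorNumber f = 0 := by
  have htop : jacobianIdeal f = ⊤ :=
    Ideal.eq_top_of_isUnit_mem _ (Ideal.subset_span ⟨i, rfl⟩) h
  have : Subsingleton (MvPowerSeries (Fin n) K ⧸ jacobianIdeal f) :=
    Ideal.Quotient.subsingleton_iff.2 htop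
  rw [milnorNumber, rank_subsingleton', map_zero]

theorem milnorNumber_eq_of_initialForm [Infinite K] (hn : 1 ≤ n) {w : Fin n → ℕ}
    (hw : ∀ i, 0 < w i) (f : MvPowerSeries (Fin n) K) {d : ℕ}
    (hfin : milnorNumber (initialForm w f) < ⊤)
    (hd : (initialForm w f).IsWeightedHomogeneous w d) :
    ∃ m : ℕ, milnorNumber f = (m : ℕ∞) ∧ milnorNumber (initialForm w f) = (m : ℕ∞) ∧
      (m : ℚ) = ∏ i : Fin n, ((d : ℚ) / (w i : ℚ) - 1) := by
  set F := initialForm w f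
  have hFfin : Module.Finite K (MvPowerSeries (Fin n) K ⧸ jacobianIdeal F) :=
    toENat_rank_lt_top_iff.1 hfin
  have hF0 : F ≠ 0 := by
    intro h0
    obtain ⟨N, hN⟩ := exists_X_pow_mem (jacobianIdeal F)
    have hbot : jacobianIdeal F = ⊥ := by
      rw [jacobianIdeal, Ideal.span_eq_bot]
      rintro _ ⟨i, rfl⟩
      simp only [h0, map_zero]
    have h1 := hN ⟨0, hn⟩
    rw [hbot, Ideal.mem_bot] at h1
    have h2 := congrArg (coeff (Finsupp.single (⟨0, hn⟩ : Fin n) N)) h1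
    rw [X_pow_eq, coeff_monomial_same, map_zero] at h2
    exact one_ne_zero h2
  -- A nonzero series has only one weighted degree, so `d` is the order of `f`.
  have hde : d = (f.weightedOrder w).toNat := by
    obtain ⟨α, hα⟩ := (ne_zero_iff_exists_coeff_ne_zero _).1 hF0
    rw [← hd hα, isWeightedHomogeneous_initialForm w f hα]
  have hfF : f - F ∈ orderIdeal w (d + 1) := hde ▸ sub_initialForm_mem w f
  by_cases hunit : ∃ i, IsUnit (pderiv K i F)
  -- A unit partial has a constant term, which forces `d = w i`. Then `∂ᵢf` is a unit too, and the
  -- factor of index `i` in the product vanishes.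
  · obtain ⟨i, hi⟩ := hunit
    have h0 : coeff 0 (pderiv K i F) ≠ 0 := by
      rw [coeff_zero_eq_constantCoeff]
      exact (isUnit_iff_constantCoeff.1 hi).ne_zero
    have hdw := weight_add_of_coeff_pderiv_ne_zero hd i h0
    rw [map_zero, zero_add] at hdw
    have hi' : IsUnit (pderiv K i f) := by
      rw [isUnit_iff_constantCoeff, isUnit_iff_ne_zero, ← coeff_zero_eq_constantCoeff_apply]
      have h1 := mem_orderIdeal.1 (pderiv_sub_mem_orderIdeal (i := i) hfF hdw.le) 0
        (by rw [map_zero]; exact Nat.succ_pos _)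
      rw [map_sub, sub_eq_zero] at h1
      rwa [h1]
    refine ⟨0, milnorNumber_eq_zero_of_isUnit hi', milnorNumber_eq_zero_of_isUnit hi, ?_⟩
    rw [Nat.cast_zero, eq_comm, Finset.prod_eq_zero (Finset.mem_univ i)]
    rw [← hdw, div_self (by exact_mod_cast (hw i).ne'), sub_self]
  · have hmax : ∀ i, pderiv K i F ∈ IsLocalRing.maximalIdeal (MvPowerSeries (Fin n) K) :=
      fun i hi => hunit ⟨i, hi⟩
    have : Module.Finite K
      (MvPowerSeries (Fin n) K ⧸ Ideal.span (Set.range fun i => pderiv K i F)) := hFfin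
    have hreg := isRegularFamily_of_finite (fun i => pderiv K i F) hmax
    have hne : ∀ i, pderiv K i F ≠ 0 := by
      intro i
      have h1 := ne_zero_of_isRegularFamily (fun j hj => by
        rw [extendFamily_of_lt _ hj]; exact hmax _) hreg i.1 i.2
      rwa [extendFamily_of_lt _ i.2] at h1
    have hwd : ∀ i, w i ≤ d := fun i => le_of_pderiv_ne_zero hd (hne i)
    let D : ℕ → ℕ := fun j => if h : j < n then d - w ⟨j, h⟩ else 0
    have hG : ∀ j < n, (extendFamily (fun i => pderiv K i F) j).IsWeightedHomogeneous w (D j) := by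
      intro j hj
      simp only [D, dif_pos hj, extendFamily_of_lt _ hj]
      exact isWeightedHomogeneous_pderiv hd _
    have hg : ∀ j < n, extendFamily (fun i => pderiv K i f) j -
        extendFamily (fun i => pderiv K i F) j ∈ orderIdeal w (D j + 1) := by
      intro j hj
      simp only [D, dif_pos hj, extendFamily_of_lt _ hj]
      exact pderiv_sub_mem_orderIdeal hfF (hwd _)
    obtain ⟨m, b, hli, hb⟩ := exists_monomial_basis (jacobianIdeal F)
    have hspan : ∀ p : MvPowerSeries (Fin n) K, jacobianIdeal p =
        Ideal.span (extendFamily (fun i => pderiv K i p) '' Finset.range n) := fun p => by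
      rw [extendFamily_image_range, jacobianIdeal]
    refine ⟨m, ?_, ?_, ?_⟩
    · rw [hspan] at hli hb hFfin
      rw [milnorNumber, rank_eq_of_monomial_basis (b := b), map_natCast]
      · rw [hspan]
        exact hreg.linearIndependent hG hg hli
      · refine exists_span_sub_mem_of_initialForms hw (fun j hj => hG j (Finset.mem_range.1 hj))
          (fun j hj => hg j (Finset.mem_range.1 hj)) (fun j hj => ?_) b hb
        rw [hspan]
        exact Ideal.subset_span ⟨j, hj, rfl⟩
    · rw [milnorNumber, rank_eq_of_monomial_basis hli hb, map_natCast]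
    · have hcard := hreg.card_mul_prod hw (fun i => isWeightedHomogeneous_pderiv hd i) hne hli hb
      have hcard' : (m : ℚ) * ∏ i, (w i : ℚ) = ∏ i, ((d : ℚ) - w i) := by
        have h1 := congrArg (Nat.cast : ℕ → ℚ) hcard
        rw [Nat.cast_mul, Nat.cast_prod, Nat.cast_prod] at h1
        rw [h1]
        exact Finset.prod_congr rfl fun i _ => Nat.cast_sub (hwd i)
      have hw0 : ∀ i, (w i : ℚ) ≠ 0 := fun i => by exact_mod_cast (hw i).ne'
      rw [← mul_left_inj' (Finset.prod_ne_zero_iff.2 fun i _ => hw0 i), hcard',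
        ← Finset.prod_mul_distrib]
      refine Finset.prod_congr rfl fun i _ => ?_
      have := hw0 i
      field_simp

end Milnor

/-! ### Invariance of finiteness under right and contact equivalence. -/

section Equivalence

theorem finite_quotient_of_map_le {I J : Ideal (MvPowerSeries (Fin n) K)}
    (φ : MvPowerSeries (Fin n) K ≃ₐ[K] MvPowerSeries (Fin n) K) (h : ∀ x ∈ I, φ x ∈ J)
    [Module.Finite K (MvPowerSeries (Fin n) K ⧸ I)] :
    Module.Finite K (MvPowerSeries (Fin n) K ⧸ J) := by
  refine Module.Finite.of_surjective
    (Ideal.quotientMapₐ J (φ : MvPowerSeries (Fin n) K →ₐ[K] MvPowerSeries (Fin n) K) h).toLinearMap ?_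
  intro y
  obtain ⟨y, rfl⟩ := Ideal.Quotient.mk_surjective y
  refine ⟨Ideal.Quotient.mk I (φ.symm y), ?_⟩
  change Ideal.Quotient.mk J (φ (φ.symm y)) = _
  rw [φ.apply_symm_apply]

theorem map_mem_jacobianIdeal (φ : MvPowerSeries (Fin n) K ≃ₐ[K] MvPowerSeries (Fin n) K)
    {f x : MvPowerSeries (Fin n) K} (hx : x ∈ jacobianIdeal f) : φ x ∈ jacobianIdeal (φ f) := by
  have hle : jacobianIdeal f ≤ (jacobianIdeal (φ f)).comap φ := by
    rw [jacobianIdeal, Ideal.span_le]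
    rintro _ ⟨i, rfl⟩
    exact map_pderiv_mem_span φ f i
  exact hle hx

theorem IsIsolatedSingularity.of_rightEquivalent {f g : MvPowerSeries (Fin n) K}
    (hf : IsIsolatedSingularity f) (h : RightEquivalent g f) : IsIsolatedSingularity g := by
  obtain ⟨φ, rfl⟩ := h
  have := toENat_rank_lt_top_iff.1 hf
  exact toENat_rank_lt_top_iff.2 (finite_quotient_of_map_le φ fun x => map_mem_jacobianIdeal φ)

/-- The product rule gives `u ∂ᵢf = ∂ᵢ(u f) - f ∂ᵢu`, and `f` is a unit multiple of `u f`. -/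
theorem tjurinaIdeal_le_unit_mul (u : (MvPowerSeries (Fin n) K)ˣ) (f : MvPowerSeries (Fin n) K) :
    tjurinaIdeal f ≤ tjurinaIdeal ((u : MvPowerSeries (Fin n) K) * f) := by
  have hf : f ∈ tjurinaIdeal ((u : MvPowerSeries (Fin n) K) * f) := by
    rw [← Ideal.unit_mul_mem_iff_mem _ u.isUnit]
    exact Ideal.mem_sup_left (Ideal.mem_span_singleton_self _)
  refine sup_le ((Ideal.span_singleton_le_iff_mem _).2 hf) ?_
  rw [jacobianIdeal, Ideal.span_le]
  rintro _ ⟨i, rfl⟩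
  have h1 : pderiv K i ((u : MvPowerSeries (Fin n) K) * f) ∈ tjurinaIdeal ((u : MvPowerSeries (Fin n) K) * f) :=
    Ideal.mem_sup_right (Ideal.subset_span ⟨i, rfl⟩)
  rw [Derivation.leibniz, smul_eq_mul, smul_eq_mul] at h1
  exact (Ideal.unit_mul_mem_iff_mem _ u.isUnit).1
    ((Ideal.add_mem_iff_left _ (Ideal.mul_mem_right _ _ hf)).1 h1)

theorem IsIsolatedHypersurfaceSingularity.of_contactEquivalent {f g : MvPowerSeries (Fin n) K}
    (hf : IsIsolatedHypersurfaceSingularity f) (h : ContactEquivalent g f) :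
    IsIsolatedHypersurfaceSingularity g := by
  obtain ⟨φ, u, rfl⟩ := h
  have : Module.Finite K (MvPowerSeries (Fin n) K ⧸ tjurinaIdeal f) :=
    toENat_rank_lt_top_iff.1 hf
  refine toENat_rank_lt_top_iff.2 (finite_quotient_of_map_le (I := tjurinaIdeal f) φ fun x hx => ?_)
  apply tjurinaIdeal_le_unit_mul
  obtain ⟨a, ha, c, hc, rfl⟩ := Submodule.mem_sup.1 hx
  rw [map_add]
  refine add_mem (Ideal.mem_sup_left ?_) (Ideal.mem_sup_right (map_mem_jacobianIdeal φ hc))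
  obtain ⟨r, rfl⟩ := Ideal.mem_span_singleton'.1 ha
  rw [map_mul]
  exact Ideal.mul_mem_left _ _ (Ideal.mem_span_singleton_self _)

end Equivalence

end PowerSeriesSingularity

theorem proposition2p3 {K : Type*} [Field K] [IsAlgClosed K] {n : ℕ} (hn : 1 ≤ n)
    (w : Fin n → ℕ) (hw : ∀ i, 0 < w i) (f : MvPowerSeries (Fin n) K) :
    -- (a)
    (∀ d : ℕ, milnorNumber (initialForm w f) < ⊤ →
      MvPowerSeries.IsWeightedHomogeneous w (initialForm w f) d →
      ∃ m : ℕ, milnorNumber f = (m : ℕ∞) ∧ milnorNumber (initialForm w f) = (m : ℕ∞) ∧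
        (m : ℚ) = ∏ i : Fin n, ((d : ℚ) / (w i : ℚ) - 1)) ∧
    -- (b)
    tjurinaNumber f ≤ tjurinaNumber (initialForm w f) ∧
    -- semi-quasihomogeneous power series are isolated
    (IsRightSemiQuasihomogeneous w f → IsIsolatedSingularity f) ∧
    (IsContactSemiQuasihomogeneous w f → IsIsolatedHypersurfaceSingularity f) ∧
    -- and so is every power series in the equivalence class of a semi-quasihomogeneous one
    (IsRightSemiQuasihomogeneous w f → ∀ g, RightEquivalent g f → IsIsolatedSingularity g) ∧
    (IsContactSemiQuasihomogeneous w f →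
      ∀ g, ContactEquivalent g f → IsIsolatedHypersurfaceSingularity g) := by
  -- Infinitude of `K` is what prime avoidance in a coset requires.
  have : Infinite K := IsAlgClosed.instInfinite
  have hR : IsRightSemiQuasihomogeneous w f → IsIsolatedSingularity f := by
    intro h
    obtain ⟨m, hm, -⟩ := milnorNumber_eq_of_initialForm hn hw f h
      (isWeightedHomogeneous_initialForm w f)
    rw [IsIsolatedSingularity, hm]
    exact ENat.natCast_lt_top m
  have hC : IsContactSemiQuasihomogeneous w f → IsIsolatedHypersurfaceSingularity f :=
    (tjurinaNumber_le_initialForm hw f).trans_lt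
  exact ⟨fun d hfin hd => milnorNumber_eq_of_initialForm hn hw f hfin hd,
    tjurinaNumber_le_initialForm hw f, hR, hC, fun h g hg => (hR h).of_rightEquivalent hg,
    fun h g hg => (hC h).of_contactEquivalent hg⟩
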